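/- Let $\Omega\subset\mathbb R^2$ be a convex open set and let $\hat f:\mathbb R^2\to\mathbb R$ be a smooth function with compact support in $\Omega$. Let the pressure $p=p(\xi,z;t)$, $\xi\in\mathbb R^2$, $z\in\mathbb R$, $t\ge 0$, be a solution, in the sense of (tempered) distributions in $(\xi,z)$, of the three-dimensional wave equation $$\partial_{tt}p=\Delta_{\xi,z}\,p\quad(t>0),\qquad p(\xi,z;0)=\hat f(\xi)\,\delta(z),\qquad \partial_t p(\xi,z;0)=0;$$ that is, $p(\cdot;t)\in\mathcal S'(\mathbb R^3)$ for every $t\ge0$, and for every Schwartz function $\varphi$ on $\mathbb R^3$ the function $t\mapsto\langle p(\cdot;t),\varphi\rangle$ has the value $\int\hat f(\xi)\varphi(\xi,0)\,d\xi$ and the one-sided derivative $0$ at $t=0$, and is twice differentiable with second derivative $\langle\Delta p(\cdot;t),\varphi\rangle$ at every $t>0$. For a distribution $T$ on $\mathbb R^3$ and a continuous function $g$ on $\mathbb R^2$, $\int_{-\infty}^\infty T(\cdot,z)\,dz=g$ means that $\langle T,\psi\otimes\chi_n\rangle\to\int\psi g\,d\xi$ for every $\psi\in C_c^\infty(\mathbb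 R^2)$ and every sequence $\chi_n\in C_c^\infty(\mathbb R)$ each of whose derivatives is bounded uniformly in $n$ and which on every bounded interval is eventually equal to $1$. For $\xi\in\mathbb R^2$ and $r>0$ let $\mathcal M_2[\hat f](\xi;r)=\frac1{2\pi}\int_{S^1}\hat f(\xi+r\theta)\,ds(\theta)$ be the circular mean, and let $\mathcal A[\psi](y)=\int_{-\infty}^\infty\psi(\sqrt{x^2+y^2})\,dx$ be the Abel transform. Then the following hold. 1. The vertical integral $\tilde p(\xi;t)=\int_{-\infty}^\infty p(\xi,z;t)\,dz$ exists for all $t\ge0$ as a continuous function of $\xi\in\mathbb R^2$. The function $\tilde p$ is of class $C^2$ on $\mathbb R^2\times[0,\infty)$ and solves the two-dimensional wave equation $$\partial_{tt}\tilde p(\xi;t)=\Delta_\xi\tilde p(\xi;t)\quad(\xi\in\mathbb R^2,\ t>0),\qquad \tilde p(\xi;0)=\hat f(\xi),\qquad \partial_t\tilde p(\xi;0)=0\quad(\xi\in\mathbb R^2).$$ 2. For all $\xi\in\mathbb R^2$ and $r>0$, with $\tilde p_\xi(s)=s^{-2}\,\tilde p(\xi;1/s)$, $$\mathcal M_2[\hat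 f](\xi;r)=\frac1{\pi r}\,\mathcal A[\tilde p_\xi]\Big(\frac1r\Big)=\frac2\pi\int_0^r\frac{\tilde p(\xi;t)}{\sqrt{r^2-t^2}}\,dt,$$ where both integrals converge absolutely. 3. Consequently, the vertical line detector data $m_1(\xi;t)=\tilde p(\xi;t)$, $\xi\in\partial\Omega$, $t>0$, and the circular means of $\hat f$ with centres on $\partial\Omega$ determine each other: for $\xi\in\partial\Omega$, $$\mathcal M_2[\hat f](\xi;r)=\frac2\pi\int_0^r\frac{m_1(\xi;t)}{\sqrt{r^2-t^2}}\,dt\quad(r>0),\qquad m_1(\xi;t)=\partial_t\int_0^t\frac{r\,\mathcal M_2[\hat f](\xi;r)}{\sqrt{t^2-r^2}}\,dr\quad(t>0),$$ where the first integral converges absolutely and the derivative in the second formula exists. -/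

import Mathlib

open scoped SchwartzMap ContDiff Topology

noncomputable section

namespace Photoacoustic

/-- The illumination plane `ℝ²`, with points `ξ`. -/
abbrev Plane : Type := EuclideanSpace ℝ (Fin 2)

/-- Euclidean space `ℝ³ = ℝ² × ℝ` (with the Euclidean norm), with points `(ξ, z)`. -/
abbrev Space3 : Type := WithLp 2 (Plane × ℝ)

/-! ### The wave equation -/

/-- `p : [0, ∞) → 𝓢'(E)` solves the initial value problem `∂ₜₜ p = Δ p` for `t > 0`, `p(0) = f`,
`∂ₜ p(0) = 0` in the sense of (tempered) distributions: time derivatives are taken after pairing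
with an arbitrary test function, the one at time `0` is one-sided, and `Δ` is the distributional
Laplacian. Values of `p` at negative times play no role. -/
structure IsDistributionalWaveSolution {E : Type*} [NormedAddCommGroup E] [InnerProductSpace ℝ E]
    [FiniteDimensional ℝ E] (p : ℝ → 𝓢'(E, ℂ)) (f : 𝓢'(E, ℂ)) : Prop where
  initial_value : p 0 = f
  initial_velocity : ∀ φ : 𝓢(E, ℂ), HasDerivWithinAt (fun t => p t φ) 0 (Set.Ici 0) 0
  differentiable : ∀ φ : 𝓢(E, ℂ), ∀ t : ℝ, 0 < t → DifferentiableAt ℝ (fun s => p s φ) t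
  wave : ∀ φ : 𝓢(E, ℂ), ∀ t : ℝ, 0 < t →
    HasDerivAt (deriv fun s => p s φ) (Laplacian.laplacian (p t) φ) t

/-- `u : E × [0, ∞) → ℝ` is a classical (`C²` up to time `0`) solution of `∂ₜₜ u = Δ u` for `t > 0`,
`u(·; 0) = f`, `∂ₜ u(·; 0) = 0`. Values of `u` at negative times play no role. -/
structure IsClassicalWaveSolution {E : Type*} [NormedAddCommGroup E] [InnerProductSpace ℝ E]
    [FiniteDimensional ℝ E] (u : E → ℝ → ℝ) (f : E → ℝ) : Prop where
  smooth : ContDiffOn ℝ 2 (fun q : E × ℝ => u q.1 q.2) (Set.univ ×ˢ Set.Ici 0)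
  wave : ∀ x : E, ∀ t : ℝ, 0 < t →
    iteratedDeriv 2 (fun s => u x s) t = Laplacian.laplacian (fun y => u y t) x
  initial_value : ∀ x : E, u x 0 = f x
  initial_velocity : ∀ x : E, HasDerivWithinAt (fun s => u x s) 0 (Set.Ici 0) 0

/-! ### The initial pressure `f(ξ, z) = f̂(ξ) δ(z)` -/

/-- The inclusion `ξ ↦ (ξ, 0)` of the illumination plane. -/
def planeIncl : Plane →L[ℝ] Space3 :=
  ((WithLp.prodContinuousLinearEquiv 2 ℝ Plane ℝ).symm : (Plane × ℝ) →L[ℝ] Space3).comp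
    (ContinuousLinearMap.inl ℝ Plane ℝ)

theorem planeIncl_apply (ξ : Plane) : planeIncl ξ = WithLp.toLp 2 (ξ, (0 : ℝ)) := rfl

theorem antilipschitz_planeIncl : AntilipschitzWith 1 planeIncl :=
  AddMonoidHomClass.antilipschitz_of_bound planeIncl fun ξ => by
    simp [planeIncl_apply]

/-- Restriction `φ ↦ φ(·, 0)` of Schwartz functions to the illumination plane. -/
def restrictPlane : 𝓢(Space3, ℂ) →L[ℂ] 𝓢(Plane, ℂ) :=
  SchwartzMap.compCLMOfAntilipschitz ℂ planeIncl.hasTemperateGrowth antilipschitz_planeIncl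

/-- A real test function as a complex-valued Schwartz function. -/
def complexTest (g : Plane → ℝ) (hg : ContDiff ℝ ∞ g) (hc : HasCompactSupport g) :
    𝓢(Plane, ℂ) :=
  HasCompactSupport.toSchwartzMap (f := fun ξ => (g ξ : ℂ))
    (hc.comp_left (g := fun y : ℝ => (y : ℂ)) Complex.ofReal_zero)
    (Complex.ofRealCLM.contDiff.comp hg)

/-- The distribution `g(ξ) δ(z)` on `ℝ³`. -/
def planarSource (g : Plane → ℝ) (hg : ContDiff ℝ ∞ g) (hc : HasCompactSupport g) :
    𝓢'(Space3, ℂ) :=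
  PointwiseConvergenceCLM.precomp ℂ restrictPlane
    (SchwartzMap.toTemperedDistributionCLM Plane ℂ MeasureTheory.volume (complexTest g hg hc))

theorem planarSource_apply (g : Plane → ℝ) (hg : ContDiff ℝ ∞ g) (hc : HasCompactSupport g)
    (φ : 𝓢(Space3, ℂ)) :
    planarSource g hg hc φ = ∫ ξ : Plane, φ (WithLp.toLp 2 (ξ, (0 : ℝ))) * (g ξ : ℂ) := by
  change SchwartzMap.toTemperedDistributionCLM Plane ℂ MeasureTheory.volume (complexTest g hg hc)
    (restrictPlane φ) = _
  exact SchwartzMap.toTemperedDistributionCLM_apply_apply MeasureTheory.volume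
    (complexTest g hg hc) (restrictPlane φ)

/-! ### Integration of a distribution along the vertical lines -/

/-- The test function `(ξ, z) ↦ ψ(ξ) χ(z)`. -/
def testTensor (ψ : 𝓢(Plane, ℂ)) (hψ : HasCompactSupport ψ)
    (χ : 𝓢(ℝ, ℂ)) (hχ : HasCompactSupport χ) : 𝓢(Space3, ℂ) :=
  HasCompactSupport.toSchwartzMap (f := fun x : Space3 => ψ x.fst * χ x.snd)
    (by
      have hK : IsCompact (WithLp.toLp 2 '' (tsupport ψ ×ˢ tsupport χ) : Set Space3) :=
        (IsCompact.prod hψ hχ).image (WithLp.prod_continuous_toLp 2 Plane ℝ)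
      refine HasCompactSupport.intro hK fun x hx => ?_
      by_contra h
      refine hx ⟨(x.fst, x.snd), ⟨subset_tsupport _ ?_, subset_tsupport _ ?_⟩, rfl⟩
      · exact left_ne_zero_of_mul h
      · exact right_ne_zero_of_mul h)
    (by
      have h₁ : ContDiff ℝ ∞ fun x : Space3 => ψ x.fst :=
        (ψ.smooth ⊤).comp ((ContinuousLinearMap.fst ℝ Plane ℝ).comp
          (WithLp.prodContinuousLinearEquiv 2 ℝ Plane ℝ : Space3 →L[ℝ] Plane × ℝ)).contDiff
      have h₂ : ContDiff ℝ ∞ fun x : Space3 => χ x.snd :=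
        (χ.smooth ⊤).comp ((ContinuousLinearMap.snd ℝ Plane ℝ).comp
          (WithLp.prodContinuousLinearEquiv 2 ℝ Plane ℝ : Space3 →L[ℝ] Plane × ℝ)).contDiff
      exact h₁.mul h₂)

/-- An approximate unit: test functions `χₙ` on `ℝ`, each derivative of which is bounded uniformly
in `n`, and which on every bounded interval are eventually equal to `1`. -/
structure IsApproximateUnit (χ : ℕ → 𝓢(ℝ, ℂ)) : Prop where
  compact : ∀ n, HasCompactSupport (χ n)
  eventually_one : ∀ R : ℝ, ∀ᶠ n in Filter.atTop, ∀ z : ℝ, |z| ≤ R → χ n z = 1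
  bounded : ∀ k : ℕ, ∃ C : ℝ, ∀ n : ℕ, ∀ z : ℝ, ‖iteratedDeriv k (χ n) z‖ ≤ C

/-- `g(ξ) = ∫ T(ξ, z) dz`: the distribution `T` on `ℝ³` is integrable along the vertical lines and
its vertical integral is the continuous function `g`. That is, `⟨T, ψ ⊗ 1⟩ = ∫ ψ(ξ) g(ξ) dξ` for all
test functions `ψ`, where `⟨T, ψ ⊗ 1⟩` is the limit of `⟨T, ψ ⊗ χₙ⟩` along every approximate unit
`(χₙ)`. -/
def HasVerticalIntegral (T : 𝓢'(Space3, ℂ)) (g : Plane → ℝ) : Prop :=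
  Continuous g ∧ ∀ (ψ : 𝓢(Plane, ℂ)) (hψ : HasCompactSupport ψ) (χ : ℕ → 𝓢(ℝ, ℂ))
    (hχ : IsApproximateUnit χ),
    Filter.Tendsto (fun n => T (testTensor ψ hψ (χ n) (hχ.compact n))) Filter.atTop
      (𝓝 (∫ ξ : Plane, ψ ξ * (g ξ : ℂ)))

/-- `P(ξ; t) = ∫ p(ξ, z; t) dz` for all `ξ ∈ ℝ²` and `t ≥ 0`. -/
def IsVerticallyIntegrated (p : ℝ → 𝓢'(Space3, ℂ)) (P : Plane → ℝ → ℝ) : Prop :=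
  ∀ t : ℝ, 0 ≤ t → HasVerticalIntegral (p t) (fun ξ => P ξ t)

/-! ### Circular means and the Abel transform -/

/-- The circular mean `M₂[f](ξ; r)`, the mean value of `θ ↦ f(ξ + r θ)` over the unit circle. -/
def circularMean (f : Plane → ℝ) (ξ : Plane) (r : ℝ) : ℝ :=
  (2 * Real.pi)⁻¹ * ∫ α in (0 : ℝ)..(2 * Real.pi), f (ξ + r • !₂[Real.cos α, Real.sin α])

/-- The Abel transform `A[ψ](y) = ∫_{-∞}^{∞} ψ(√(x² + y²)) dx`. -/
def abelTransform (ψ : ℝ → ℝ) (y : ℝ) : ℝ :=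
  ∫ x : ℝ, ψ (Real.sqrt (x ^ 2 + y ^ 2))

end Photoacoustic

end

noncomputable section

namespace SchwartzMap

open Filter

variable {E F : Type*} [NormedAddCommGroup E] [NormedSpace ℝ E]
  [NormedAddCommGroup F] [NormedSpace ℝ F]

/-! ### Completeness of the Schwartz space -/

/-! The vertical integral must be the planar wave with initial data `(f, 0)`, which is written down
by Fourier transform (`pressure`). To see that every distributional solution `p` integrates to it,
`p` is paired with translates: `u(a, s) = ⟨p(|s|), φ(· - a)⟩` is a smooth, time-even, classical wave
on space-time. Since `p` is only weakly regular in time, joint regularity in `(a, s)` rests on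
Banach–Steinhaus in the Schwartz space, hence on its completeness; weak equations then bootstrap
(`contDiff_translatePairing`).

For classical waves an energy estimate in a smoothed cone gives uniqueness with finite propagation
speed. For `φ = ψ ⊗ χ` with `χ = 1` on `[-(T + 2), T + 2]`, the initial values of `u` on the ball of
radius `T + 2` do not see `χ`. They agree there with those of the planar wave averaged against `ψ`,
regarded as a `z`-independent wave on `ℝ³`. So `⟨p(T), ψ ⊗ χ⟩` equals the planar pairing exactly
(`pairing_testTensor_eq`), and the limit along an approximate unit is that of an eventually constant
sequence.

The circular means come from plane waves: as `ω` runs over the unit circle, `k · rω` takes the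
values `r |k| sin(α + γ)`, which are also the phases at the fixed centre at times `r sin(α + γ)`.
Hence averaging `f` over a circle is averaging the planar wave over the times `r sin α` at its
centre (`circularMean_eq_sineIntegral`). The substitutions `t = r sin φ` and `u = tan θ / r` turn
this average into the two stated integrals.

For the converse, a second such average with weight `sin θ` collapses to the plain integral `∫₀^τ`
of the wave, by Archimedes' hat-box theorem (`integral_sin_mul_sineIntegral`), and the fundamental
theorem of calculus recovers the data. -/

instance isCountablyGenerated_uniformity : (uniformity 𝓢(E, F)).IsCountablyGenerated :=
  IsUniformAddGroup.uniformity_countably_generated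

theorem iteratedFDeriv_sub_apply' (f g : 𝓢(E, F)) (l : ℕ) (x : E) :
    iteratedFDeriv ℝ l (f - g) x = iteratedFDeriv ℝ l f x - iteratedFDeriv ℝ l g x :=
  iteratedFDeriv_sub_apply ((f.smooth l).contDiffAt) ((g.smooth l).contDiffAt)

theorem cauchySeq_seminorm_sub_lt {u : ℕ → 𝓢(E, F)} (hu : CauchySeq u) (k l : ℕ) {ε : ℝ}
    (hε : 0 < ε) : ∃ N, ∀ m ≥ N, ∀ n ≥ N, SchwartzMap.seminorm ℝ k l (u m - u n) < ε := by
  have h := (cauchySeq_iff_tendsto.1 hu)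
  rw [uniformity_eq_comap_nhds_zero_swapped, tendsto_comap_iff,
    (schwartz_withSeminorms ℝ E F).tendsto_nhds] at h
  have h := h (k, l) ε hε
  rw [Filter.eventually_atTop_prod_self] at h
  obtain ⟨N, hN⟩ := h
  exact ⟨N, fun m hm n hn => by simpa using hN m n hm hn⟩

/-- The unweighted seminorms make all derivatives converge uniformly, so the limits form a Taylor
series. The weighted Cauchy estimates pass to the limit pointwise and give both decay of the limit
and convergence in every seminorm. -/
theorem exists_tendsto_of_cauchySeq [CompleteSpace F] {u : ℕ → 𝓢(E, F)} (hu : CauchySeq u) :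
    ∃ v : 𝓢(E, F), Tendsto u atTop (𝓝 v) := by
  have hunif : ∀ l, UniformCauchySeqOn (fun n x => iteratedFDeriv ℝ l (u n) x) atTop Set.univ := by
    intro l
    rw [Metric.uniformCauchySeqOn_iff]
    intro ε hε
    obtain ⟨N, hN⟩ := cauchySeq_seminorm_sub_lt hu 0 l hε
    refine ⟨N, fun m hm n hn x _ => ?_⟩
    rw [dist_eq_norm, ← iteratedFDeriv_sub_apply']
    have := (u m - u n).le_seminorm ℝ 0 l x
    simp only [pow_zero, one_mul] at this
    exact this.trans_lt (hN m hm n hn)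
  have hlim : ∀ l x, ∃ y, Tendsto (fun n => iteratedFDeriv ℝ l (u n) x) atTop (𝓝 y) := fun l x =>
    cauchySeq_tendsto_of_complete ((hunif l).cauchySeq (Set.mem_univ x))
  choose g hg using hlim
  have hgu : ∀ l, TendstoUniformly (fun n x => iteratedFDeriv ℝ l (u n) x) (g l) atTop := fun l =>
    tendstoUniformlyOn_univ.1 ((hunif l).tendstoUniformlyOn_of_tendsto fun x _ => hg l x)
  have htaylor : HasFTaylorSeriesUpTo (∞ : WithTop ℕ∞) (fun x => (g 0 x).curry0)
      (fun x l => g l x) := by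
    refine ⟨fun x => rfl, fun m _ x => ?_, fun m _ => ?_⟩
    · refine hasFDerivAt_of_tendstoUniformly (l := atTop)
        (f := fun n x => iteratedFDeriv ℝ m (u n) x)
        (f' := fun n x => (iteratedFDeriv ℝ (m + 1) (u n) x).curryLeft)
        (g' := fun x => (g (m + 1) x).curryLeft) ?_ ?_ (hg m) x
      · exact (continuousMultilinearCurryLeftEquiv ℝ (fun _ : Fin (m + 1) => E) F).isometry
          |>.uniformContinuous.comp_tendstoUniformly (hgu (m + 1))
      · intro n x
        exact ((contDiff_iff_ftaylorSeries (𝕜 := ℝ)).1 ((u n).smooth ⊤)).fderiv m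
          (by exact_mod_cast ENat.natCast_lt_top m) x
    · exact (hgu m).continuous (Frequently.of_forall fun n =>
        ((u n).smooth m).continuous_iteratedFDeriv le_rfl)
  have hder : ∀ l x, iteratedFDeriv ℝ l (fun x => (g 0 x).curry0) x = g l x := fun l x =>
    (htaylor.eq_iteratedFDeriv (by exact_mod_cast le_top) x).symm
  have hclose : ∀ k l, ∀ ε > 0, ∃ N, ∀ n ≥ N, ∀ x,
      ‖x‖ ^ k * ‖iteratedFDeriv ℝ l (u n) x - g l x‖ ≤ ε := by
    intro k l ε hε
    obtain ⟨N, hN⟩ := cauchySeq_seminorm_sub_lt hu k l hε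
    refine ⟨N, fun n hn x => ?_⟩
    have ht : Tendsto (fun m => ‖x‖ ^ k * ‖iteratedFDeriv ℝ l (u n) x - iteratedFDeriv ℝ l (u m) x‖)
        atTop (𝓝 (‖x‖ ^ k * ‖iteratedFDeriv ℝ l (u n) x - g l x‖)) :=
      ((tendsto_const_nhds.sub (hg l x)).norm).const_mul _
    refine le_of_tendsto ht ?_
    filter_upwards [eventually_ge_atTop N] with m hm
    rw [← iteratedFDeriv_sub_apply']
    exact ((u n - u m).le_seminorm ℝ k l x).trans (hN n hn m hm).le
  let v : 𝓢(E, F) :=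
    { toFun := fun x => (g 0 x).curry0
      smooth' := htaylor.contDiff
      decay' := by
        intro k l
        obtain ⟨N, hN⟩ := hclose k l 1 one_pos
        refine ⟨1 + SchwartzMap.seminorm ℝ k l (u N), fun x => ?_⟩
        rw [hder]
        have h1 := hN N le_rfl x
        have h2 := (u N).le_seminorm ℝ k l x
        have h3 : ‖g l x‖ ≤ ‖iteratedFDeriv ℝ l (u N) x - g l x‖ + ‖iteratedFDeriv ℝ l (u N) x‖ := by
          rw [norm_sub_rev]
          simpa using norm_add_le (g l x - iteratedFDeriv ℝ l (u N) x) (iteratedFDeriv ℝ l (u N) x)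
        calc _ ≤ ‖x‖ ^ k * (‖iteratedFDeriv ℝ l (u N) x - g l x‖ + ‖iteratedFDeriv ℝ l (u N) x‖) := by
              gcongr
          _ ≤ _ := by rw [mul_add]; exact add_le_add h1 h2 }
  refine ⟨v, ((schwartz_withSeminorms ℝ E F).tendsto_nhds u v).2 fun kl ε hε => ?_⟩
  obtain ⟨N, hN⟩ := hclose kl.1 kl.2 (ε / 2) (half_pos hε)
  filter_upwards [eventually_ge_atTop N] with n hn
  refine lt_of_le_of_lt (SchwartzMap.seminorm_le_bound ℝ kl.1 kl.2 (u n - v) (half_pos hε).le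
    fun x => ?_) (half_lt_self hε)
  rw [iteratedFDeriv_sub_apply']
  have : iteratedFDeriv ℝ kl.2 v x = g kl.2 x := hder kl.2 x
  rw [this]
  exact hN n hn x

instance completeSpace [CompleteSpace F] : CompleteSpace 𝓢(E, F) :=
  UniformSpace.complete_of_cauchySeq_tendsto fun _ hu => exists_tendsto_of_cauchySeq hu

/-- The countably generated uniformity comes from a complete pseudometric. The Baire property makes
Banach–Steinhaus available for tempered distributions. -/
instance baireSpace [CompleteSpace F] : BaireSpace 𝓢(E, F) := by
  let := UniformSpace.pseudoMetricSpace 𝓢(E, F)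
  infer_instance

end SchwartzMap
end

noncomputable section

namespace SchwartzMap

open Filter LineDeriv

section Translation

variable {E F : Type*} [NormedAddCommGroup E] [NormedSpace ℝ E]
  [NormedAddCommGroup F] [NormedSpace ℝ F]

/-! ### Translations of Schwartz functions -/

theorem lineDerivOp_lineDerivOp_comm (φ : 𝓢(E, F)) (v w : E) : ∂_{v} (∂_{w} φ) = ∂_{w} (∂_{v} φ) := by
  ext x
  have h : ∀ v w : E, (∂_{v} (∂_{w} φ) : 𝓢(E, F)) x = fderiv ℝ (fderiv ℝ φ) x v w := by
    intro v w
    rw [lineDerivOp_apply_eq_fderiv]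
    have : ⇑(∂_{w} φ : 𝓢(E, F)) = fun y => fderiv ℝ φ y w :=
      funext fun y => lineDerivOp_apply_eq_fderiv w φ y
    rw [this, fderiv_clm_apply]
    · simp
    · exact (((φ.smooth 2).fderiv_right (m := 1) (by norm_num)).differentiable one_ne_zero) x
    · exact differentiableAt_const _
  rw [h, h]
  have hs : IsSymmSndFDerivAt ℝ φ x := (φ.smooth 2).contDiffAt.isSymmSndFDerivAt (by simp)
  exact hs v w

theorem iteratedLineDerivOp_lineDerivOp_comm (φ : 𝓢(E, F)) (v : E) {l : ℕ} (m : Fin l → E) :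
    ∂^{m} (∂_{v} φ) = ∂_{v} (∂^{m} φ) := by
  induction l with
  | zero => simp
  | succ l ih =>
    rw [iteratedLineDerivOp_succ_left, iteratedLineDerivOp_succ_left, ih,
      lineDerivOp_lineDerivOp_comm]

theorem fderiv_iteratedFDeriv_apply (φ : 𝓢(E, F)) (l : ℕ) (x v : E) :
    fderiv ℝ (iteratedFDeriv ℝ l φ) x v = iteratedFDeriv ℝ l (∂_{v} φ : 𝓢(E, F)) x := by
  ext m
  rw [← iteratedLineDerivOp_eq_iteratedFDeriv, iteratedLineDerivOp_lineDerivOp_comm,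
    lineDerivOp_apply_eq_fderiv, ← fderiv_continuousMultilinear_apply_const_apply]
  · simp only [← iteratedLineDerivOp_eq_iteratedFDeriv]
  · exact (φ.smooth ⊤).differentiable_iteratedFDeriv (mod_cast ENat.natCast_lt_top l) x

/-- The weight stays at `x` while the derivative moves to a nearby `y`, as the mean value inequality
on a unit ball requires; `‖x‖ ≤ 1 + ‖y‖` absorbs the shift. -/
theorem exists_pow_mul_norm_iteratedFDeriv_le (φ : 𝓢(E, F)) (k l : ℕ) :
    ∃ C, 0 ≤ C ∧ ∀ x y : E, ‖y - x‖ ≤ 1 → ‖x‖ ^ k * ‖iteratedFDeriv ℝ l φ y‖ ≤ C := by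
  refine ⟨2 ^ k * ((Finset.Iic (k, l)).sup fun m => SchwartzMap.seminorm ℝ m.1 m.2) φ,
    by positivity, fun x y hxy => ?_⟩
  have h1 : ‖x‖ ≤ 1 + ‖y‖ := by
    have := norm_sub_norm_le x y
    rw [norm_sub_rev] at this
    linarith
  refine le_trans ?_ (one_add_le_sup_seminorm_apply (𝕜 := ℝ) (m := (k, l)) le_rfl le_rfl φ y)
  gcongr

theorem exists_pow_mul_norm_iteratedFDeriv_sub_le (φ : 𝓢(E, F)) (k l : ℕ) :
    ∃ C, 0 ≤ C ∧ ∀ x y : E, ‖y - x‖ ≤ 1 →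
      ‖x‖ ^ k * ‖iteratedFDeriv ℝ l φ y - iteratedFDeriv ℝ l φ x‖ ≤ C * ‖y - x‖ := by
  obtain ⟨C, hC, h⟩ := exists_pow_mul_norm_iteratedFDeriv_le φ k (l + 1)
  refine ⟨C, hC, fun x y hxy => ?_⟩
  have hd : Differentiable ℝ (iteratedFDeriv ℝ l φ) :=
    (φ.smooth ⊤).differentiable_iteratedFDeriv (mod_cast ENat.natCast_lt_top l)
  have := Convex.norm_image_sub_le_of_norm_fderiv_le (𝕜 := ℝ)
    (f := fun y => ‖x‖ ^ k • iteratedFDeriv ℝ l φ y) (s := Metric.closedBall x 1) (C := C)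
    (x := x) (y := y) (fun z _ => (hd z).fun_const_smul _) (fun z hz => ?_) (convex_closedBall x 1)
    (by simp) (by simpa [dist_eq_norm] using hxy)
  · simpa only [← smul_sub, norm_smul, norm_pow, norm_norm] using this
  · rw [fderiv_fun_const_smul (hd z), norm_smul, norm_pow, norm_norm, norm_fderiv_iteratedFDeriv]
    exact h x z (by simpa [dist_eq_norm] using hz)

/-- Mean value inequality for the derivative minus its linear part at `x`: on the ball of radius
`‖a‖` the gradient of the difference is itself `O(‖a‖)` by a first-order bound one order higher. -/
theorem exists_pow_mul_norm_taylor_le (φ : 𝓢(E, F)) (k l : ℕ) :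
    ∃ C, 0 ≤ C ∧ ∀ x a : E, ‖a‖ ≤ 1 →
      ‖x‖ ^ k * ‖iteratedFDeriv ℝ l φ (x - a) - iteratedFDeriv ℝ l φ x
        + iteratedFDeriv ℝ l (∂_{a} φ : 𝓢(E, F)) x‖ ≤ C * ‖a‖ ^ 2 := by
  obtain ⟨C, hC, h⟩ := exists_pow_mul_norm_iteratedFDeriv_sub_le φ k (l + 1)
  refine ⟨C, hC, fun x a ha => ?_⟩
  have hd : Differentiable ℝ (iteratedFDeriv ℝ l φ) :=
    (φ.smooth ⊤).differentiable_iteratedFDeriv (mod_cast ENat.natCast_lt_top l)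
  set L := fderiv ℝ (iteratedFDeriv ℝ l φ) x
  have hG : ∀ z, HasFDerivAt (fun y => ‖x‖ ^ k • (iteratedFDeriv ℝ l φ y - L y))
      (‖x‖ ^ k • (fderiv ℝ (iteratedFDeriv ℝ l φ) z - L)) z := fun z =>
    ((hd z).hasFDerivAt.fun_sub L.hasFDerivAt).fun_const_smul _
  have := Convex.norm_image_sub_le_of_norm_hasFDerivWithin_le (𝕜 := ℝ)
    (s := Metric.closedBall x ‖a‖) (C := C * ‖a‖)
    (x := x) (y := x - a) (fun z _ => (hG z).hasFDerivWithinAt) (fun z hz => ?_)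
    (convex_closedBall x _) (by simp) (by simp)
  · rw [← smul_sub, norm_smul, norm_pow, norm_norm] at this
    have e : iteratedFDeriv ℝ l φ (x - a) - L (x - a) - (iteratedFDeriv ℝ l φ x - L x) =
        iteratedFDeriv ℝ l φ (x - a) - iteratedFDeriv ℝ l φ x + iteratedFDeriv ℝ l (∂_{a} φ : 𝓢(E, F)) x := by
      rw [← fderiv_iteratedFDeriv_apply, map_sub]
      abel
    rw [e] at this
    calc _ ≤ _ := this
      _ = _ := by rw [sub_sub_cancel_left, norm_neg]; ring
  · have hz : ‖z - x‖ ≤ ‖a‖ := by simpa [dist_eq_norm] using hz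
    rw [norm_smul, norm_pow, norm_norm, fderiv_iteratedFDeriv, Function.comp_apply]
    have hL : L = continuousMultilinearCurryLeftEquiv ℝ (fun _ : Fin (l + 1) => E) F
        (iteratedFDeriv ℝ (l + 1) φ x) := by
      simp only [L, fderiv_iteratedFDeriv, Function.comp_apply]
    rw [hL, ← LinearIsometryEquiv.map_sub, LinearIsometryEquiv.norm_map]
    exact (h x z (hz.trans ha)).trans (by gcongr)

end Translation

/-! ### Translation estimates in the Schwartz seminorms -/

section

variable {E : Type*} [NormedAddCommGroup E] [NormedSpace ℝ E]

theorem iteratedFDeriv_compSubConst (φ : 𝓢(E, ℂ)) (a : E) (l : ℕ) (x : E) :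
    iteratedFDeriv ℝ l (φ.compSubConstCLM ℂ a) x = iteratedFDeriv ℝ l φ (x - a) :=
  iteratedFDeriv_comp_sub (𝕜 := ℝ) (f := φ) l a x

theorem lineDerivOp_compSubConst (φ : 𝓢(E, ℂ)) (a v : E) :
    ∂_{v} (φ.compSubConstCLM ℂ a) = (∂_{v} φ).compSubConstCLM ℂ a := by
  ext x
  rw [compSubConstCLM_apply, lineDerivOp_apply_eq_fderiv, lineDerivOp_apply_eq_fderiv]
  exact DFunLike.congr_fun (fderiv_comp_sub (𝕜 := ℝ) (f := φ) a) v

theorem exists_seminorm_translate_sub_le (φ : 𝓢(E, ℂ)) (k l : ℕ) :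
    ∃ C, 0 ≤ C ∧ ∀ a : E, ‖a‖ ≤ 1 →
      SchwartzMap.seminorm ℂ k l (φ.compSubConstCLM ℂ a - φ) ≤ C * ‖a‖ := by
  obtain ⟨C, hC, h⟩ := exists_pow_mul_norm_iteratedFDeriv_sub_le φ k l
  refine ⟨C, hC, fun a ha => seminorm_le_bound ℂ k l _ (by positivity) fun x => ?_⟩
  rw [iteratedFDeriv_sub_apply', iteratedFDeriv_compSubConst]
  have := h x (x - a) (by simpa using ha)
  simpa using this

theorem exists_seminorm_translate_taylor_le (φ : 𝓢(E, ℂ)) (k l : ℕ) :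
    ∃ C, 0 ≤ C ∧ ∀ a : E, ‖a‖ ≤ 1 →
      SchwartzMap.seminorm ℂ k l (φ.compSubConstCLM ℂ a - φ + ∂_{a} φ) ≤ C * ‖a‖ ^ 2 := by
  obtain ⟨C, hC, h⟩ := exists_pow_mul_norm_taylor_le φ k l
  refine ⟨C, hC, fun a ha => seminorm_le_bound ℂ k l _ (by positivity) fun x => ?_⟩
  have e : iteratedFDeriv ℝ l (φ.compSubConstCLM ℂ a - φ + ∂_{a} φ) x =
      iteratedFDeriv ℝ l φ (x - a) - iteratedFDeriv ℝ l φ x + iteratedFDeriv ℝ l (∂_{a} φ : 𝓢(E, ℂ)) x := by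
    rw [← iteratedFDeriv_compSubConst, ← iteratedFDeriv_sub_apply']
    exact iteratedFDeriv_add_apply ((φ.compSubConstCLM ℂ a - φ).smooth l).contDiffAt
      ((∂_{a} φ : 𝓢(E, ℂ)).smooth l).contDiffAt
  rw [e]
  exact h x a ha

theorem continuous_translate (φ : 𝓢(E, ℂ)) : Continuous fun a : E => φ.compSubConstCLM ℂ a := by
  rw [continuous_iff_continuousAt]
  intro a₀
  refine ((schwartz_withSeminorms ℂ E ℂ).tendsto_nhds _ _).2 fun kl ε hε => ?_
  obtain ⟨C, hC, h⟩ := exists_seminorm_translate_sub_le (φ.compSubConstCLM ℂ a₀) kl.1 kl.2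
  have ht : Tendsto (fun a => C * ‖a - a₀‖) (𝓝 a₀) (𝓝 0) := by
    have : Continuous fun a : E => C * ‖a - a₀‖ := by fun_prop
    simpa using this.tendsto a₀
  filter_upwards [ht.eventually_lt_const hε, Metric.ball_mem_nhds a₀ one_pos] with a h1 h2
  have := h (a - a₀) ((mem_ball_iff_norm.1 h2).le)
  rw [compSubConstCLM_comp, add_sub_cancel] at this
  exact this.trans_lt h1

end

section

variable {E : Type*} [NormedAddCommGroup E] [InnerProductSpace ℝ E] [FiniteDimensional ℝ E]

theorem laplacian_compSubConst (φ : 𝓢(E, ℂ)) (a : E) :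
    Laplacian.laplacian (φ.compSubConstCLM ℂ a) = (Laplacian.laplacian φ).compSubConstCLM ℂ a := by
  rw [laplacian_eq_sum (stdOrthonormalBasis ℝ E), laplacian_eq_sum (stdOrthonormalBasis ℝ E)]
  simp only [lineDerivOp_compSubConst, map_sum]

end

end SchwartzMap

end

noncomputable section

namespace Photoacoustic

open Filter LineDeriv SchwartzMap

variable {E : Type*} [NormedAddCommGroup E] [InnerProductSpace ℝ E]

/-! ### Pairing a family of tempered distributions with translates -/

/-- The seminorm `φ ↦ |T φ|`. -/
def absSeminorm (T : 𝓢'(E, ℂ)) : Seminorm ℂ 𝓢(E, ℂ) :=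
  (normSeminorm ℂ ℂ).comp (T.toLinearMap)

theorem continuous_absSeminorm (T : 𝓢'(E, ℂ)) : Continuous (absSeminorm T) :=
  T.continuous.norm

/-- Banach–Steinhaus for a family of tempered distributions depending weakly continuously on a
parameter. -/
theorem exists_seminorm_bound {q : ℝ → 𝓢'(E, ℂ)} (hq : ∀ φ, Continuous fun s => q s φ) (R : ℝ) :
    ∃ P : Seminorm ℂ 𝓢(E, ℂ), Continuous P ∧ ∀ s ∈ Set.Icc (-R) R, ∀ φ, ‖q s φ‖ ≤ P φ := by
  have hb : BddAbove (Set.range fun s : Set.Icc (-R) R => absSeminorm (q s)) := by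
    rw [Seminorm.bddAbove_range_iff]
    intro φ
    obtain ⟨C, hC⟩ := (isCompact_Icc (a := -R) (b := R)).exists_bound_of_continuousOn
      (hq φ).continuousOn
    refine ⟨C, ?_⟩
    rintro _ ⟨s, rfl⟩
    exact hC s s.2
  refine ⟨⨆ s : Set.Icc (-R) R, absSeminorm (q s), ?_, fun s hs φ => ?_⟩
  · rw [Seminorm.coe_iSup_eq hb]
    -- The uniform boundedness principle: a Baire space is barrelled, so a pointwise bounded
    -- supremum of continuous seminorms is continuous.
    exact Seminorm.continuous_iSup _ (fun s => continuous_absSeminorm _) hb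
  · have : absSeminorm (q s) ≤ ⨆ s : Set.Icc (-R) R, absSeminorm (q s) :=
      le_ciSup (f := fun s : Set.Icc (-R) R => absSeminorm (q s)) hb ⟨s, hs⟩
    exact this φ

/-- Weak continuity in time alone would give only separate continuity; local equicontinuity controls
`q s (Φ x - Φ x₀)` uniformly in `s` near `s₀`. -/
theorem continuous_pairing {X : Type*} [TopologicalSpace X] {q : ℝ → 𝓢'(E, ℂ)}
    (hq : ∀ φ, Continuous fun s => q s φ) {Φ : X → 𝓢(E, ℂ)} (hΦ : Continuous Φ) :
    Continuous fun x : X × ℝ => q x.2 (Φ x.1) := by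
  rw [continuous_iff_continuousAt]
  rintro ⟨x₀, s₀⟩
  obtain ⟨P, hP, hb⟩ := exists_seminorm_bound hq (|s₀| + 1)
  have h1 : Tendsto (fun x : X × ℝ => P (Φ x.1 - Φ x₀) + ‖q x.2 (Φ x₀) - q s₀ (Φ x₀)‖)
      (𝓝 (x₀, s₀)) (𝓝 0) := by
    have : Continuous fun x : X × ℝ => P (Φ x.1 - Φ x₀) + ‖q x.2 (Φ x₀) - q s₀ (Φ x₀)‖ :=
      (hP.comp ((hΦ.comp continuous_fst).sub continuous_const)).add
        ((((hq (Φ x₀)).comp continuous_snd).sub continuous_const).norm)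
    simpa using this.tendsto (x₀, s₀)
  rw [ContinuousAt, tendsto_iff_norm_sub_tendsto_zero]
  refine squeeze_zero' (Eventually.of_forall fun _ => norm_nonneg _) ?_ h1
  have h2 : ∀ᶠ x : X × ℝ in 𝓝 (x₀, s₀), |x.2 - s₀| < 1 := by
    have : Continuous fun x : X × ℝ => |x.2 - s₀| := by fun_prop
    exact this.tendsto (x₀, s₀) |>.eventually_lt_const (by simp)
  filter_upwards [h2] with x hx
  have hmem : x.2 ∈ Set.Icc (-(|s₀| + 1)) (|s₀| + 1) := by
    rw [Set.mem_Icc, ← abs_le]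
    have := abs_sub_abs_le_abs_sub x.2 s₀
    linarith
  have e : q x.2 (Φ x.1) - q s₀ (Φ x₀) =
      q x.2 (Φ x.1 - Φ x₀) + (q x.2 (Φ x₀) - q s₀ (Φ x₀)) := by
    rw [map_sub]; ring
  show ‖q x.2 (Φ x.1) - q s₀ (Φ x₀)‖ ≤ _
  rw [e]
  exact (norm_add_le _ _).trans (add_le_add (hb _ hmem _) le_rfl)

variable [FiniteDimensional ℝ E]

/-- The gradient `v ↦ T (∂ᵥ φ)`. -/
def pairingGradient (T : 𝓢'(E, ℂ)) (φ : 𝓢(E, ℂ)) : E →L[ℝ] ℂ :=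
  ∑ i, (innerSL ℝ (stdOrthonormalBasis ℝ E i)).smulRight
    (T (∂_{stdOrthonormalBasis ℝ E i} φ))

theorem pairingGradient_apply (T : 𝓢'(E, ℂ)) (φ : 𝓢(E, ℂ)) (v : E) :
    pairingGradient T φ v = T (∂_{v} φ) := by
  have h : (∂_{v} φ : 𝓢(E, ℂ)) = ∑ i, (inner ℝ (stdOrthonormalBasis ℝ E i) v : ℝ) •
      (∂_{stdOrthonormalBasis ℝ E i} φ : 𝓢(E, ℂ)) := by
    ext x
    rw [lineDerivOp_apply_eq_fderiv]
    conv_lhs => rw [← (stdOrthonormalBasis ℝ E).sum_repr' v]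
    simp only [map_sum, map_smul, _root_.sum_apply, _root_.smul_apply,
      lineDerivOp_apply_eq_fderiv]
  rw [h, map_sum]
  simp only [pairingGradient, _root_.sum_apply, ContinuousLinearMap.smulRight_apply,
    innerSL_apply_apply]
  refine Finset.sum_congr rfl fun i _ => ?_
  rw [← Complex.coe_smul, ← Complex.coe_smul (x := inner ℝ (stdOrthonormalBasis ℝ E i) v), map_smul]

/-- `T` is dominated by finitely many Schwartz seminorms, in each of which the first-order Taylor
remainder of a translation is quadratically small. -/
theorem hasFDerivAt_pairing_translate (T : 𝓢'(E, ℂ)) (φ : 𝓢(E, ℂ)) (a : E) :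
    HasFDerivAt (fun a => T (φ.compSubConstCLM ℂ a))
      (-pairingGradient T (φ.compSubConstCLM ℂ a)) a := by
  set ψ := φ.compSubConstCLM ℂ a with hψ
  obtain ⟨s, C, -, hC⟩ := Seminorm.bound_of_continuous (schwartz_withSeminorms ℂ E ℂ)
    (absSeminorm T) (continuous_absSeminorm T)
  choose D hD0 hD using fun kl : ℕ × ℕ => exists_seminorm_translate_taylor_le ψ kl.1 kl.2
  rw [hasFDerivAt_iff_isLittleO_nhds_zero]
  have hO : (fun h : E => T (φ.compSubConstCLM ℂ (a + h)) - T ψ -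
      (-pairingGradient T ψ) h) =O[𝓝 0] fun h => ‖h‖ ^ 2 := by
    refine Asymptotics.IsBigO.of_bound (C * ∑ i ∈ s, D i) ?_
    filter_upwards [Metric.ball_mem_nhds (0 : E) one_pos] with h hh
    have hh : ‖h‖ ≤ 1 := (mem_ball_zero_iff.1 hh).le
    have e : T (φ.compSubConstCLM ℂ (a + h)) - T ψ - (-pairingGradient T ψ) h =
        T (ψ.compSubConstCLM ℂ h - ψ + ∂_{h} ψ) := by
      rw [hψ, compSubConstCLM_comp, ← hψ, map_add, map_sub, _root_.neg_apply,
        pairingGradient_apply, sub_neg_eq_add]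
    rw [e, norm_pow, norm_norm]
    calc ‖T (ψ.compSubConstCLM ℂ h - ψ + ∂_{h} ψ)‖ ≤ _ := hC _
      _ ≤ C * ∑ i ∈ s, SchwartzMap.seminorm ℂ i.1 i.2 (ψ.compSubConstCLM ℂ h - ψ + ∂_{h} ψ) := by
          rw [_root_.smul_apply, NNReal.smul_def, smul_eq_mul]
          gcongr
          refine (Seminorm.finset_sup_le_sum _ s _).trans_eq ?_
          simp [schwartzSeminormFamily]
      _ ≤ C * ∑ i ∈ s, D i * ‖h‖ ^ 2 := by
          gcongr with i _
          exact hD i h hh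
      _ = _ := by rw [← Finset.sum_mul, mul_assoc]
  refine hO.trans_isLittleO ?_
  have := Asymptotics.isLittleO_norm_pow_id (E' := E) (n := 2) (by norm_num)
  simpa using this

/-- A pair `(q, q')` of families of tempered distributions on the whole time axis with
`∂ₜ q = q'` and `∂ₜ q' = Δ q` weakly. -/
structure IsWavePair (q q' : ℝ → 𝓢'(E, ℂ)) : Prop where
  hasDerivAt_fst : ∀ φ s, HasDerivAt (fun s => q s φ) (q' s φ) s
  hasDerivAt_snd : ∀ φ s, HasDerivAt (fun s => q' s φ) (Laplacian.laplacian (q s) φ) s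

namespace IsWavePair

variable {q q' : ℝ → 𝓢'(E, ℂ)}

/-- Wave pairs are closed under time differentiation, which is what lets regularity be bootstrapped.
-/
theorem deriv (h : IsWavePair q q') : IsWavePair q' fun s => Laplacian.laplacian (q s) where
  hasDerivAt_fst := h.hasDerivAt_snd
  hasDerivAt_snd φ s := by
    simp only [TemperedDistribution.laplacian_apply_apply]
    exact h.hasDerivAt_fst _ s

theorem continuous (h : IsWavePair q q') (φ : 𝓢(E, ℂ)) : Continuous fun s => q s φ :=
  continuous_iff_continuousAt.2 fun s => (h.hasDerivAt_fst φ s).continuousAt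

end IsWavePair

/-- The function `(a, s) ↦ ⟨q(s), φ(· - a)⟩`. -/
def translatePairing (q : ℝ → 𝓢'(E, ℂ)) (φ : 𝓢(E, ℂ)) (x : E × ℝ) : ℂ :=
  q x.2 (φ.compSubConstCLM ℂ x.1)

namespace IsWavePair

variable {q q' : ℝ → 𝓢'(E, ℂ)}

/-- The derivative of `translatePairing`. -/
def fderivPairing (q q' : ℝ → 𝓢'(E, ℂ)) (φ : 𝓢(E, ℂ)) (x : E × ℝ) : E × ℝ →L[ℝ] ℂ :=
  (-∑ i, (innerSL ℝ (stdOrthonormalBasis ℝ E i)).smulRight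
    (translatePairing q (∂_{stdOrthonormalBasis ℝ E i} φ) x)).coprod
  (ContinuousLinearMap.toSpanSingleton ℝ (translatePairing q' φ x))

theorem neg_sum_eq (q : ℝ → 𝓢'(E, ℂ)) (φ : 𝓢(E, ℂ)) (x : E × ℝ) :
    (-∑ i, (innerSL ℝ (stdOrthonormalBasis ℝ E i)).smulRight
      (translatePairing q (∂_{stdOrthonormalBasis ℝ E i} φ) x)) =
    -pairingGradient (q x.2) (φ.compSubConstCLM ℂ x.1) := by
  simp only [pairingGradient, lineDerivOp_compSubConst, translatePairing]

theorem fderivPairing_apply (q q' : ℝ → 𝓢'(E, ℂ)) (φ : 𝓢(E, ℂ)) (x v : E × ℝ) :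
    fderivPairing q q' φ x v =
      -translatePairing q (∂_{v.1} φ) x + v.2 • translatePairing q' φ x := by
  rw [fderivPairing, neg_sum_eq, ContinuousLinearMap.coprod_apply, _root_.neg_apply,
    pairingGradient_apply, lineDerivOp_compSubConst]
  rfl

theorem continuous_translatePairing (h : IsWavePair q q') (φ : 𝓢(E, ℂ)) :
    Continuous (translatePairing q φ) :=
  continuous_pairing h.continuous (continuous_translate φ)

theorem hasFDerivAt_translatePairing (h : IsWavePair q q') (φ : 𝓢(E, ℂ)) (x : E × ℝ) :
    HasFDerivAt (translatePairing q φ) (fderivPairing q q' φ x) x := by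
  refine (hasStrictFDerivAt_uncurry_coprod (𝕜 := ℝ) (u := x)
    (f := fun a s => q s (φ.compSubConstCLM ℂ a))
    (f₁ := fun a s => -∑ i, (innerSL ℝ (stdOrthonormalBasis ℝ E i)).smulRight
      (translatePairing q (∂_{stdOrthonormalBasis ℝ E i} φ) (a, s)))
    (f₂ := fun a s => ContinuousLinearMap.toSpanSingleton ℝ (translatePairing q' φ (a, s)))
    (Eventually.of_forall fun y => ?_) (Eventually.of_forall fun y => ?_) ?_ ?_).hasFDerivAt
  · have := hasFDerivAt_pairing_translate (q y.2) φ y.1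
    rw [← neg_sum_eq q φ y] at this
    exact this
  · exact (h.hasDerivAt_fst (φ.compSubConstCLM ℂ y.1) y.2).hasFDerivAt
  · refine Continuous.continuousAt (Continuous.neg (continuous_finsetSum _ fun i _ => ?_))
    exact (ContinuousLinearMap.smulRightL ℝ E ℂ (innerSL ℝ (stdOrthonormalBasis ℝ E i))).continuous.comp
      (continuous_translatePairing h _)
  · refine Continuous.continuousAt ?_
    exact (ContinuousLinearMap.toSpanSingletonCLE (𝕜 := ℝ) (E := ℂ)).continuous.comp
      (continuous_translatePairing h.deriv _)

/-- The partial derivatives of a pairing are again pairings, with `∂ᵥ φ` in space and with the next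
wave pair in time. The induction therefore has to range over all pairs and all `φ`. -/
theorem contDiff_translatePairing (n : ℕ) : ∀ {q q' : ℝ → 𝓢'(E, ℂ)} (_ : IsWavePair q q')
    (φ : 𝓢(E, ℂ)), ContDiff ℝ n (translatePairing q φ) := by
  induction n with
  | zero => exact fun h φ => contDiff_zero.2 (continuous_translatePairing h φ)
  | succ n ih =>
    intro q q' h φ
    push_cast
    refine (contDiff_succ_iff_hasFDerivAt).2 ⟨fderivPairing q q' φ, ?_,
      hasFDerivAt_translatePairing h φ⟩
    refine contDiff_clm_apply_iff.2 fun v => ?_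
    simp only [fderivPairing_apply]
    exact (ih h _).neg.add ((ih h.deriv φ).const_smul v.2)

theorem fderiv_translatePairing_apply (h : IsWavePair q q') (φ : 𝓢(E, ℂ)) (x v : E × ℝ) :
    fderiv ℝ (translatePairing q φ) x v =
      -translatePairing q (∂_{v.1} φ) x + v.2 • translatePairing q' φ x := by
  rw [(hasFDerivAt_translatePairing h φ x).fderiv, fderivPairing_apply]

end IsWavePair

end Photoacoustic
end

noncomputable section

namespace Photoacoustic

open Filter MeasureTheory

/-! ### Classical wave functions on space-time and finite propagation speed -/

section

variable {E F : Type*} [NormedAddCommGroup E] [InnerProductSpace ℝ E] [FiniteDimensional ℝ E]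
  [NormedAddCommGroup F] [NormedSpace ℝ F]

/-- `u : E × ℝ → F` is of class `C²` and `∂ₜₜ u = Δ u`. -/
structure IsWaveFunction (u : E × ℝ → F) : Prop where
  contDiff : ContDiff ℝ 2 u
  wave : ∀ x, iteratedFDeriv ℝ 2 u x ![(0, 1), (0, 1)] =
    ∑ i, iteratedFDeriv ℝ 2 u x
      ![(stdOrthonormalBasis ℝ E i, 0), (stdOrthonormalBasis ℝ E i, 0)]

theorem iteratedFDeriv_two_eq_fderiv_fderiv {V : Type*} [NormedAddCommGroup V] [NormedSpace ℝ V]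
    {u : V → F} (hu : ContDiff ℝ 2 u) (x v w : V) :
    iteratedFDeriv ℝ 2 u x ![v, w] = fderiv ℝ (fun y => fderiv ℝ u y w) x v := by
  have h : DifferentiableAt ℝ (fderiv ℝ u) x :=
    (hu.fderiv_right (m := 1) (by norm_num)).differentiable one_ne_zero x
  rw [iteratedFDeriv_two_apply, fderiv_clm_apply h (differentiableAt_const _)]
  simp

theorem IsWaveFunction.sub {u v : E × ℝ → F} (hu : IsWaveFunction u) (hv : IsWaveFunction v) :
    IsWaveFunction fun x => u x - v x where
  contDiff := hu.contDiff.sub hv.contDiff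
  wave x := by
    have h : ∀ m, iteratedFDeriv ℝ 2 (fun x => u x - v x) x m =
        iteratedFDeriv ℝ 2 u x m - iteratedFDeriv ℝ 2 v x m := fun m => by
      exact DFunLike.congr_fun (iteratedFDeriv_sub_apply (hu.contDiff.contDiffAt (x := x))
        (hv.contDiff.contDiffAt (x := x))) m
    simp only [h, hu.wave, hv.wave, Finset.sum_sub_distrib]

theorem IsWaveFunction.add {u v : E × ℝ → F} (hu : IsWaveFunction u) (hv : IsWaveFunction v) :
    IsWaveFunction fun x => u x + v x where
  contDiff := hu.contDiff.add hv.contDiff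
  wave x := by
    have h : ∀ m, iteratedFDeriv ℝ 2 (fun x => u x + v x) x m =
        iteratedFDeriv ℝ 2 u x m + iteratedFDeriv ℝ 2 v x m := fun m => by
      exact DFunLike.congr_fun (iteratedFDeriv_add_apply (hu.contDiff.contDiffAt (x := x))
        (hv.contDiff.contDiffAt (x := x))) m
    simp only [h, hu.wave, hv.wave, Finset.sum_add_distrib]

theorem IsWaveFunction.clm_comp {G : Type*} [NormedAddCommGroup G] [NormedSpace ℝ G]
    {u : E × ℝ → F} (hu : IsWaveFunction u) (l : F →L[ℝ] G) :
    IsWaveFunction fun x => l (u x) where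
  contDiff := l.contDiff.comp hu.contDiff
  wave x := by
    have h : ∀ m, iteratedFDeriv ℝ 2 (fun x => l (u x)) x m = l (iteratedFDeriv ℝ 2 u x m) :=
      fun m => by
        have := l.iteratedFDeriv_comp_left (hu.contDiff.contDiffAt (x := x)) (i := 2) le_rfl
        exact DFunLike.congr_fun this m
    simp only [h, hu.wave, map_sum]

/-- Two space derivatives fall on `φ` with cancelling signs; two time derivatives produce the
distributional Laplacian, which moves to `φ` and commutes with translation. -/
theorem IsWavePair.isWaveFunction {q q' : ℝ → 𝓢'(E, ℂ)} (h : IsWavePair q q') (φ : 𝓢(E, ℂ)) :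
    IsWaveFunction (translatePairing q φ) where
  contDiff := IsWavePair.contDiff_translatePairing 2 h φ
  wave x := by
    have hc := IsWavePair.contDiff_translatePairing 2 h φ
    simp only [iteratedFDeriv_two_eq_fderiv_fderiv hc, h.fderiv_translatePairing_apply]
    have h0 : ∀ (r : ℝ → 𝓢'(E, ℂ)) (y : E × ℝ),
        translatePairing r (LineDeriv.lineDerivOp (0 : E) φ) y = 0 := by
      intro r y
      have : LineDeriv.lineDerivOp (0 : E) φ = (0 : 𝓢(E, ℂ)) := by
        ext z
        simp
      rw [this]
      simp [translatePairing]
    simp only [h0, neg_zero, zero_add, one_smul, zero_smul, add_zero]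
    have e : (fun y => translatePairing q' φ y) = translatePairing q' φ := rfl
    rw [e, h.deriv.fderiv_translatePairing_apply]
    rw [h0, neg_zero, zero_add, one_smul]
    have h1 : ∀ v : E, fderiv ℝ (fun y => -translatePairing q (LineDeriv.lineDerivOp v φ) y) x (v, 0) =
        translatePairing q (LineDeriv.lineDerivOp v (LineDeriv.lineDerivOp v φ)) x := by
      intro v
      rw [fderiv_fun_neg, _root_.neg_apply, h.fderiv_translatePairing_apply]
      simp
    simp only [h1]
    simp only [translatePairing, TemperedDistribution.laplacian_apply_apply,
      SchwartzMap.laplacian_compSubConst]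
    rw [SchwartzMap.laplacian_eq_sum (stdOrthonormalBasis ℝ E), map_sum, map_sum]

end

/-! ### A smoothed backward light cone -/

section Cone

variable {E : Type*} [NormedAddCommGroup E] [InnerProductSpace ℝ E]

theorem hasFDerivAt_slice {G : E × ℝ → ℝ} (hG : ContDiff ℝ 1 G) (a : E) (s : ℝ) :
    HasFDerivAt (fun a => G (a, s))
      ((fderiv ℝ G (a, s)).comp (ContinuousLinearMap.inl ℝ E ℝ)) a :=
  ((hG.differentiable one_ne_zero) (a, s)).hasFDerivAt.comp a
    (hasFDerivAt_prodMk_left a s)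

/-- A smooth cutoff supported in the cone `√(1 + |a|²) + s ≤ S`. -/
def coneCutoff (S : ℝ) (x : E × ℝ) : ℝ :=
  Real.smoothTransition (S - (√(1 + ‖x.1‖ ^ 2) + x.2))

theorem hasFDerivAt_coneCutoff (S : ℝ) (x : E × ℝ) :
    HasFDerivAt (coneCutoff S) (-(deriv Real.smoothTransition (S - (√(1 + ‖x.1‖ ^ 2) + x.2))) •
      ((√(1 + ‖x.1‖ ^ 2))⁻¹ • (innerSL ℝ x.1).comp (ContinuousLinearMap.fst ℝ E ℝ) +
        ContinuousLinearMap.snd ℝ E ℝ)) x := by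
  have hpos : (0 : ℝ) < 1 + ‖x.1‖ ^ 2 := by positivity
  have h1 : HasFDerivAt (fun x : E × ℝ => 1 + ‖x.1‖ ^ 2)
      (2 • (innerSL ℝ x.1).comp (ContinuousLinearMap.fst ℝ E ℝ)) x :=
    ((hasStrictFDerivAt_norm_sq x.1).hasFDerivAt.comp x hasFDerivAt_fst).const_add 1
  have h2 := h1.sqrt hpos.ne'
  have h3 := ((h2.add (hasFDerivAt_snd (𝕜 := ℝ) (p := x))).const_sub S)
  have h4 : HasDerivAt Real.smoothTransition _ (S - (√(1 + ‖x.1‖ ^ 2) + x.2)) :=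
    ((Real.smoothTransition.contDiff (n := 1)).differentiable one_ne_zero _).hasDerivAt
  refine (h4.comp_hasFDerivAt x h3).congr_fderiv ?_
  ext v
  · simp
    field_simp
    simp
  · simp

theorem contDiff_coneCutoff (S : ℝ) : ContDiff ℝ 1 (coneCutoff (E := E) S) := by
  refine Real.smoothTransition.contDiff.comp (contDiff_const.sub (ContDiff.add ?_ contDiff_snd))
  refine ContDiff.sqrt (contDiff_const.add ((contDiff_norm_sq ℝ).comp contDiff_fst)) fun x => ?_
  positivity

end Cone

/-! ### Integrals over time slices -/

section Energy

variable {E : Type*} [NormedAddCommGroup E] [InnerProductSpace ℝ E] [FiniteDimensional ℝ E]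
  [MeasurableSpace E] [BorelSpace E]

/-- Integration by parts against the constant `1`; this removes the divergence terms from the energy
identity. -/
theorem integral_fderiv_slice_eq_zero {G : E × ℝ → ℝ} (hG : ContDiff ℝ 1 G) (s : ℝ)
    (hc : HasCompactSupport fun a => G (a, s)) (v : E) :
    ∫ a, fderiv ℝ G (a, s) (v, 0) = 0 := by
  have hcont : Continuous fun a => G (a, s) := hG.continuous.comp (by fun_prop)
  have hd : ∀ a, fderiv ℝ (fun a => G (a, s)) a v = fderiv ℝ G (a, s) (v, 0) := fun a => by
    rw [(hasFDerivAt_slice hG a s).fderiv]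
    simp
  have hdc : Continuous fun a => fderiv ℝ (fun a => G (a, s)) a v := by
    simp only [hd]
    exact (((hG.continuous_fderiv one_ne_zero).comp
      (by fun_prop : Continuous fun a : E => (a, s))).clm_apply continuous_const)
  have := integral_mul_fderiv_eq_neg_fderiv_mul_of_integrable (μ := (volume : Measure E))
    (𝕜 := ℝ) (f := fun _ => (1 : ℝ)) (g := fun a => G (a, s)) (v := v) (by simp)
    (by simpa using hdc.integrable_of_hasCompactSupport (hc.fderiv_apply ℝ v))
    (by simpa using hcont.integrable_of_hasCompactSupport hc)
    (fun x _ => differentiableAt_const _)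
    (fun x _ => (hasFDerivAt_slice hG x s).differentiableAt)
  simpa [hd] using this

theorem hasDerivAt_setIntegral_slice {G : E × ℝ → ℝ} (hG : ContDiff ℝ 1 G) {K : Set E}
    (hK : IsCompact K) (s : ℝ) :
    HasDerivAt (fun s => ∫ a in K, G (a, s)) (∫ a in K, fderiv ℝ G (a, s) (0, 1)) s := by
  have hc' : Continuous fun x : E × ℝ => fderiv ℝ G x (0, 1) :=
    (hG.continuous_fderiv one_ne_zero).clm_apply continuous_const
  obtain ⟨C, hC⟩ := (hK.prod (isCompact_Icc (a := s - 1) (b := s + 1))).exists_bound_of_continuousOn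
    hc'.continuousOn
  have hslice : ∀ s', Continuous fun a => G (a, s') := fun s' => hG.continuous.comp (by fun_prop)
  refine (hasDerivAt_integral_of_dominated_loc_of_deriv_le (μ := volume.restrict K)
    (F := fun s a => G (a, s)) (F' := fun s a => fderiv ℝ G (a, s) (0, 1)) (bound := fun _ => C)
    (s := Metric.ball s 1) (Metric.ball_mem_nhds s one_pos) ?_ ?_ ?_ ?_ ?_ ?_).2
  · exact Eventually.of_forall fun s' => (hslice s').aestronglyMeasurable
  · exact (hslice s).continuousOn.integrableOn_compact hK
  · exact (hc'.comp (by fun_prop : Continuous fun a : E => (a, s))).aestronglyMeasurable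
  · filter_upwards [ae_restrict_mem hK.measurableSet] with a ha s' hs'
    refine hC (a, s') ⟨ha, ?_⟩
    rw [Metric.mem_ball, Real.dist_eq, abs_lt] at hs'
    constructor <;> linarith [hs'.1, hs'.2]
  · exact integrableOn_const hK.measure_lt_top.ne
  · refine Eventually.of_forall fun a s' _ => ?_
    have := ((hG.differentiable one_ne_zero) (a, s')).hasFDerivAt.comp s'
      (hasFDerivAt_prodMk_right a s')
    simpa using! this.hasDerivAt

end Energy

end Photoacoustic
end

noncomputable section

namespace Photoacoustic

open Filter MeasureTheory

section

variable {E : Type*} [NormedAddCommGroup E]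

theorem coneCutoff_eq_zero {S : ℝ} {a : E} {s : ℝ} (hs : 0 ≤ s) (ha : S ≤ ‖a‖) :
    coneCutoff S (a, s) = 0 := by
  refine Real.smoothTransition.zero_of_nonpos ?_
  have : ‖a‖ ≤ √(1 + ‖a‖ ^ 2) := Real.le_sqrt_of_sq_le (by linarith)
  simp only
  linarith

theorem coneCutoff_nonneg (S : ℝ) (x : E × ℝ) : 0 ≤ coneCutoff S x :=
  Real.smoothTransition.nonneg _

theorem deriv_smoothTransition_nonneg (x : ℝ) : 0 ≤ deriv Real.smoothTransition x :=
  Real.smoothTransition.monotone.deriv_nonneg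

variable [InnerProductSpace ℝ E]

theorem fderiv_coneCutoff_apply (S : ℝ) (x v : E × ℝ) :
    fderiv ℝ (coneCutoff S) x v =
      -(deriv Real.smoothTransition (S - (√(1 + ‖x.1‖ ^ 2) + x.2))) *
        (inner ℝ x.1 v.1 / √(1 + ‖x.1‖ ^ 2) + v.2) := by
  rw [(hasFDerivAt_coneCutoff S x).fderiv]
  simp [div_eq_inv_mul]
  ring

end

/-! ### The energy estimate -/

section

variable {E : Type*} [NormedAddCommGroup E] [InnerProductSpace ℝ E] [FiniteDimensional ℝ E]

/-- The gradient of `√(1 + |a|²)` has norm less than `1`, so the cutoff decreases in time at least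
as fast as it varies in space. The energy density `(A² + |B|²) / 2` then dominates the flux `A B` in
any direction of length at most `1`. -/
theorem coneCutoff_flux_nonpos (S : ℝ) (x : E × ℝ) (A : ℝ)
    (B : Fin (Module.finrank ℝ E) → ℝ) :
    fderiv ℝ (coneCutoff S) x (0, 1) * ((A ^ 2 + ∑ i, B i ^ 2) / 2) -
      ∑ i, fderiv ℝ (coneCutoff S) x (stdOrthonormalBasis ℝ E i, 0) * (A * B i) ≤ 0 := by
  simp only [fderiv_coneCutoff_apply, inner_zero_right, zero_div, zero_add, mul_one, add_zero]
  set h := deriv Real.smoothTransition (S - (√(1 + ‖x.1‖ ^ 2) + x.2))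
  have hh : 0 ≤ h := deriv_smoothTransition_nonneg _
  set c : Fin (Module.finrank ℝ E) → ℝ := fun i =>
    inner ℝ x.1 (stdOrthonormalBasis ℝ E i) / √(1 + ‖x.1‖ ^ 2)
  have hpos : (0 : ℝ) < 1 + ‖x.1‖ ^ 2 := by positivity
  have hc : ∑ i, c i ^ 2 ≤ 1 := by
    have h1 : ∑ i, c i ^ 2 = ‖x.1‖ ^ 2 / (1 + ‖x.1‖ ^ 2) := by
      rw [← (stdOrthonormalBasis ℝ E).sum_sq_norm_inner_left x.1, Finset.sum_div]
      refine Finset.sum_congr rfl fun i _ => ?_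
      rw [(stdOrthonormalBasis ℝ E).sum_sq_norm_inner_left x.1]
      simp only [c, div_pow, Real.sq_sqrt hpos.le, Real.norm_eq_abs, sq_abs]
    rw [h1, div_le_one hpos]
    linarith
  have hs : ∑ i, c i * (A * B i) ≤ (A ^ 2 + ∑ i, B i ^ 2) / 2 := by
    calc ∑ i, c i * (A * B i) ≤ ∑ i, (c i ^ 2 * A ^ 2 + B i ^ 2) / 2 :=
          Finset.sum_le_sum fun i _ => by nlinarith [sq_nonneg (c i * A - B i)]
      _ = ((∑ i, c i ^ 2) * A ^ 2 + ∑ i, B i ^ 2) / 2 := by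
          rw [← Finset.sum_div, Finset.sum_add_distrib, Finset.sum_mul]
      _ ≤ _ := by nlinarith [sq_nonneg A]
  have e : ∑ i, -h * c i * (A * B i) = -h * ∑ i, c i * (A * B i) := by
    rw [Finset.mul_sum]
    exact Finset.sum_congr rfl fun i _ => by ring
  change -h * _ - ∑ i, -h * c i * (A * B i) ≤ 0
  rw [e]
  nlinarith

/-- Finite propagation speed: a real `C²` solution of the wave equation with vanishing Cauchy data
on the ball of radius `T + 2` vanishes at `(0, T)`. -/
theorem IsWaveFunction.eq_zero_of_cauchyData {u : E × ℝ → ℝ} (hu : IsWaveFunction u) {T : ℝ}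
    (hT : 0 ≤ T) (h0 : ∀ a, ‖a‖ < T + 2 → u (a, 0) = 0)
    (h1 : ∀ a, ‖a‖ < T + 2 → fderiv ℝ u (a, 0) (0, 1) = 0) : u (0, T) = 0 := by
  borelize E
  set b := stdOrthonormalBasis ℝ E with hb
  set A : E × ℝ → ℝ := fun x => fderiv ℝ u x (0, 1) with hA
  set B : Fin (Module.finrank ℝ E) → E × ℝ → ℝ := fun i x => fderiv ℝ u x (b i, 0) with hB
  have hdu : ContDiff ℝ 1 (fderiv ℝ u) := hu.contDiff.fderiv_right (by norm_num)
  have hAc : ContDiff ℝ 1 A := hdu.clm_apply contDiff_const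
  have hBc : ∀ i, ContDiff ℝ 1 (B i) := fun i => hdu.clm_apply contDiff_const
  have hAt : ∀ x, fderiv ℝ A x (0, 1) = ∑ i, fderiv ℝ (B i) x (b i, 0) := fun x => by
    have := hu.wave x
    simpa only [iteratedFDeriv_two_eq_fderiv_fderiv hu.contDiff] using this
  -- Symmetry of the second derivative of `u`.
  have hBt : ∀ i x, fderiv ℝ (B i) x (0, 1) = fderiv ℝ A x (b i, 0) := fun i x => by
    rw [← iteratedFDeriv_two_eq_fderiv_fderiv hu.contDiff,
      ← iteratedFDeriv_two_eq_fderiv_fderiv hu.contDiff, iteratedFDeriv_two_apply,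
      iteratedFDeriv_two_apply]
    exact (hu.contDiff.contDiffAt.isSymmSndFDerivAt (by simp)) _ _
  set w : E × ℝ → ℝ := coneCutoff (T + 2) with hw
  have hwc : ContDiff ℝ 1 w := contDiff_coneCutoff _
  set e : E × ℝ → ℝ := fun x => (A x ^ 2 + ∑ i, B i x ^ 2) / 2 with he
  have hec : ContDiff ℝ 1 e :=
    ((hAc.pow 2).add (ContDiff.sum fun i _ => (hBc i).pow 2)).div_const 2
  set G : E × ℝ → ℝ := fun x => w x * e x with hG
  have hGc : ContDiff ℝ 1 G := hwc.mul hec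
  set J : Fin (Module.finrank ℝ E) → E × ℝ → ℝ := fun i x => w x * (A x * B i x) with hJ
  have hJc : ∀ i, ContDiff ℝ 1 (J i) := fun i => hwc.mul (hAc.mul (hBc i))
  have d1 : ∀ {g : E × ℝ → ℝ}, ContDiff ℝ 1 g → ∀ x, HasFDerivAt g (fderiv ℝ g x) x :=
    fun hg x => (hg.differentiable one_ne_zero x).hasFDerivAt
  have hJd : ∀ i x v, fderiv ℝ (J i) x v = fderiv ℝ w x v * (A x * B i x) +
      w x * (fderiv ℝ A x v * B i x + A x * fderiv ℝ (B i) x v) := fun i x v => by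
    have h : HasFDerivAt (J i) _ x := (d1 hwc x).mul ((d1 hAc x).mul (d1 (hBc i) x))
    rw [h.fderiv]
    simp
    ring
  have hed : ∀ x v, fderiv ℝ e x v = A x * fderiv ℝ A x v + ∑ i, B i x * fderiv ℝ (B i) x v := by
    intro x v
    have h : HasFDerivAt e _ x := (((d1 hAc x).pow 2).add
      (HasFDerivAt.fun_sum (u := Finset.univ) fun i _ => (d1 (hBc i) x).pow 2)).mul_const (2⁻¹ : ℝ)
    rw [h.fderiv]
    simp [Finset.mul_sum]
    refine congrArg₂ _ (by ring) (Finset.sum_congr rfl fun i _ => by ring)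
  have hGd : ∀ x v, fderiv ℝ G x v = fderiv ℝ w x v * e x + w x * fderiv ℝ e x v := fun x v => by
    have h : HasFDerivAt G _ x := (d1 hwc x).mul (d1 hec x)
    rw [h.fderiv]
    simp
    ring
  -- The local energy identity is `∂ₛ G = R + ∑ ∂ᵢ Jᵢ`: `R` collects every term in which the cutoff
  -- is differentiated, and it is nonpositive.
  set R : E × ℝ → ℝ := fun x => fderiv ℝ w x (0, 1) * e x -
    ∑ i, fderiv ℝ w x (b i, 0) * (A x * B i x) with hR
  have hRnonpos : ∀ x, R x ≤ 0 := fun x => coneCutoff_flux_nonpos (T + 2) x (A x) fun i => B i x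
  have hkey : ∀ x, fderiv ℝ G x (0, 1) = R x + ∑ i, fderiv ℝ (J i) x (b i, 0) := fun x => by
    rw [hGd, hed, hAt]
    simp only [hBt, hJd, hR, Finset.sum_add_distrib, Finset.mul_sum, mul_add]
    have : ∀ i, w x * (B i x * fderiv ℝ A x (b i, 0)) = w x * (fderiv ℝ A x (b i, 0) * B i x) :=
      fun i => by ring
    simp only [this]
    ring
  set K : Set E := Metric.closedBall 0 (T + 2) with hK
  have hKc : IsCompact K := isCompact_closedBall 0 _
  have hsupp : ∀ i s, 0 ≤ s → Function.support (fun a => J i (a, s)) ⊆ K := by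
    intro i s hs a ha
    by_contra hn
    rw [hK, mem_closedBall_zero_iff, not_le] at hn
    exact ha (by simp only [hJ, hw, coneCutoff_eq_zero hs hn.le, zero_mul])
  have htsupp : ∀ i s, 0 ≤ s → tsupport (fun a => J i (a, s)) ⊆ K := fun i s hs =>
    closure_minimal (hsupp i s hs) Metric.isClosed_closedBall
  have hJint : ∀ i s, 0 ≤ s → ∫ a in K, fderiv ℝ (J i) (a, s) (b i, 0) = 0 := by
    intro i s hs
    rw [setIntegral_eq_integral_of_forall_compl_eq_zero]
    · exact integral_fderiv_slice_eq_zero (hJc i) s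
        (HasCompactSupport.of_support_subset_isCompact hKc (hsupp i s hs)) _
    · intro a ha
      have h2 : fderiv ℝ (fun a => J i (a, s)) a = 0 := by
        by_contra hne
        exact ha (htsupp i s hs (support_fderiv_subset ℝ hne))
      have h3 := (hasFDerivAt_slice (hJc i) a s).fderiv
      rw [h2] at h3
      have := DFunLike.congr_fun h3 (b i)
      simpa using this.symm
  have hder : ∀ s, HasDerivAt (fun s => ∫ a in K, G (a, s))
      (∫ a in K, fderiv ℝ G (a, s) (0, 1)) s := fun s => hasDerivAt_setIntegral_slice hGc hKc s
  have hcs : ∀ {g : E × ℝ → ℝ}, ContDiff ℝ 1 g → ∀ v s, IntegrableOn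
      (fun a => fderiv ℝ g (a, s) v) K := fun hg v s =>
    (((hg.continuous_fderiv one_ne_zero).clm_apply continuous_const).comp
      (by fun_prop : Continuous fun a : E => (a, s))).continuousOn.integrableOn_compact hKc
  have hderle : ∀ s, 0 ≤ s → ∫ a in K, fderiv ℝ G (a, s) (0, 1) ≤ 0 := by
    intro s hs
    have : ∫ a in K, (fderiv ℝ G (a, s) (0, 1) - ∑ i, fderiv ℝ (J i) (a, s) (b i, 0)) ≤ 0 :=
      integral_nonpos fun a => by
        simp only [hkey, add_sub_cancel_right]
        exact hRnonpos _
    rw [integral_sub (hcs hGc _ s) (integrable_finsetSum _ fun i _ => hcs (hJc i) _ s),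
      integral_finsetSum _ fun i _ => hcs (hJc i) _ s] at this
    simpa [hJint _ s hs] using this
  have hanti : AntitoneOn (fun s => ∫ a in K, G (a, s)) (Set.Ici 0) := by
    refine antitoneOn_of_deriv_nonpos (convex_Ici 0)
      (fun s _ => (hder s).continuousAt.continuousWithinAt)
      (fun s _ => (hder s).differentiableAt.differentiableWithinAt) fun s hs => ?_
    rw [interior_Ici] at hs
    rw [(hder s).deriv]
    exact hderle s hs.le
  have hG0 : ∀ x, 0 ≤ G x := fun x => mul_nonneg (coneCutoff_nonneg _ _) (by positivity)
  have hinit : ∫ a in K, G (a, 0) = 0 := by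
    have : ∀ a, G (a, 0) = 0 := by
      intro a
      by_cases ha : ‖a‖ < T + 2
      · have hA0 : A (a, 0) = 0 := h1 a ha
        have hB0 : ∀ i, B i (a, 0) = 0 := by
          intro i
          -- The ball is open, so vanishing of `u` on it also kills its spatial derivatives.
          have h2 : (fun a => u (a, 0)) =ᶠ[𝓝 a] fun _ => 0 := by
            have : Metric.ball (0 : E) (T + 2) ∈ 𝓝 a :=
              Metric.isOpen_ball.mem_nhds (mem_ball_zero_iff.2 ha)
            filter_upwards [this] with y hy using h0 y (mem_ball_zero_iff.1 hy)
          have h3 := (hasFDerivAt_slice (hu.contDiff.of_le (by norm_num)) a 0).fderiv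
          rw [h2.fderiv_eq] at h3
          have := DFunLike.congr_fun h3 (b i)
          simpa [hB] using this.symm
        simp [hG, he, hA0, hB0]
      · simp only [hG, hw, coneCutoff_eq_zero le_rfl (not_lt.1 ha), zero_mul]
    simp [this]
  have hzero : ∀ s, 0 ≤ s → ∀ a, G (a, s) = 0 := by
    intro s hs a
    by_cases ha : ‖a‖ < T + 2
    · have h2 : ∫ a in K, G (a, s) = 0 :=
        le_antisymm ((hanti Set.self_mem_Ici hs hs).trans hinit.le)
          (integral_nonneg fun a => hG0 _)
      have hcont : Continuous fun a => G (a, s) := hGc.continuous.comp (by fun_prop)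
      rw [setIntegral_eq_zero_iff_of_nonneg_ae (Eventually.of_forall fun a => hG0 _)
        (hcont.continuousOn.integrableOn_compact hKc)] at h2
      have h3 : (fun a => G (a, s)) =ᵐ[volume.restrict (Metric.ball (0 : E) (T + 2))] 0 :=
        ae_restrict_of_ae_restrict_of_subset Metric.ball_subset_closedBall h2
      exact Measure.eqOn_open_of_ae_eq h3 Metric.isOpen_ball hcont.continuousOn
        continuousOn_const (mem_ball_zero_iff.2 ha)
    · simp only [hG, hw, coneCutoff_eq_zero hs (not_lt.1 ha), zero_mul]
  have hA0 : ∀ s ∈ Set.Icc 0 T, A (0, s) = 0 := by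
    intro s hs
    -- On the axis the argument of the transition is `T + 2 - (1 + s) ≥ 1`; the `1` lost to the
    -- smoothed norm at the origin is why the radius exceeds `T`.
    have hwpos : 0 < w (0, s) := by
      refine Real.smoothTransition.pos_of_pos ?_
      simp
      linarith [hs.2]
    have he0 : e (0, s) = 0 := by
      have := hzero s hs.1 0
      exact (mul_eq_zero.1 this).resolve_left hwpos.ne'
    have hB2 : 0 ≤ ∑ i, B i (0, s) ^ 2 := Finset.sum_nonneg fun i _ => sq_nonneg _
    have : A (0, s) ^ 2 = 0 := by
      simp only [he] at he0
      nlinarith [sq_nonneg (A (0, s))]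
    exact pow_eq_zero_iff two_ne_zero |>.1 this
  have hud : ∀ s, HasDerivAt (fun s => u ((0 : E), s)) (A (0, s)) s := fun s => by
    have := ((hu.contDiff.differentiable two_ne_zero) ((0 : E), s)).hasFDerivAt.comp s
      (hasFDerivAt_prodMk_right (0 : E) s)
    simpa using! this.hasDerivAt
  have := constant_of_has_deriv_right_zero (f := fun s => u ((0 : E), s)) (a := 0) (b := T)
    (fun s _ => (hud s).continuousAt.continuousWithinAt)
    (fun s hs => by
      rw [← hA0 s ⟨hs.1, hs.2.le⟩]
      exact (hud s).hasDerivWithinAt) T ⟨hT, le_rfl⟩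
  simpa using this.trans (h0 0 (by simp; linarith))

end

end Photoacoustic
end

noncomputable section

namespace Photoacoustic

open Filter MeasureTheory

variable {E : Type*} [NormedAddCommGroup E] [InnerProductSpace ℝ E] [FiniteDimensional ℝ E]

/-! ### Distributional wave solutions and wave pairs -/

theorem continuous_laplacian :
    Continuous fun φ : 𝓢(E, ℂ) => (Laplacian.laplacian φ : 𝓢(E, ℂ)) := by
  have := (LineDeriv.laplacianCLM ℂ E 𝓢(E, ℂ)).continuous
  exact this.congr fun φ => SchwartzMap.laplacianCLM_eq (𝕜 := ℂ) φ

theorem laplacian_add_smul (φ ψ : 𝓢(E, ℂ)) (c : ℂ) :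
    (Laplacian.laplacian (φ + c • ψ) : 𝓢(E, ℂ)) =
      Laplacian.laplacian φ + c • Laplacian.laplacian ψ := by
  simp only [← SchwartzMap.laplacianCLM_eq (𝕜 := ℂ), map_add, map_smul]

/-- This supplies the velocity of a wave starting at rest. The uniform bound on `[-|s|, |s|]` makes
the integral a continuous functional of `φ`. -/
theorem exists_timePrimitive_laplacian {q : ℝ → 𝓢'(E, ℂ)} (hq : ∀ φ, Continuous fun s => q s φ)
    (s : ℝ) : ∃ T : 𝓢'(E, ℂ), ∀ φ, T φ = ∫ σ in (0 : ℝ)..s, q σ (Laplacian.laplacian φ) := by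
  obtain ⟨P, hP, hb⟩ := exists_seminorm_bound hq |s|
  have hint : ∀ φ, IntervalIntegrable (fun σ => q σ φ) volume 0 s := fun φ =>
    (hq φ).intervalIntegrable _ _
  let L : 𝓢(E, ℂ) →ₗ[ℂ] ℂ :=
    { toFun := fun φ => ∫ σ in (0 : ℝ)..s, q σ (Laplacian.laplacian φ)
      map_add' := fun φ ψ => by
        have := laplacian_add_smul φ ψ 1
        simp only [one_smul] at this
        simp only [this, map_add]
        exact intervalIntegral.integral_add (hint _) (hint _)
      map_smul' := fun c φ => by
        have := laplacian_add_smul 0 φ c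
        have h0 : (Laplacian.laplacian (0 : 𝓢(E, ℂ)) : 𝓢(E, ℂ)) = 0 := by
          simp only [← SchwartzMap.laplacianCLM_eq (𝕜 := ℂ), map_zero]
        simp only [h0, zero_add] at this
        simp only [this, map_smul, RingHom.id_apply]
        exact intervalIntegral.integral_smul _ _ }
  have hL : Continuous L := by
    refine continuous_of_continuousAt_zero L ?_
    have hle : ∀ φ, ‖L φ‖ ≤ P (Laplacian.laplacian φ) * |s - 0| := fun φ =>
      intervalIntegral.norm_integral_le_of_norm_le_const fun σ hσ => by
        refine hb σ ?_ _
        rw [Set.mem_Icc, ← abs_le]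
        rcases Set.mem_uIoc.1 hσ with h | h
        · rw [abs_of_pos h.1]
          exact h.2.trans (le_abs_self s)
        · rw [abs_of_nonpos h.2, abs_of_nonpos (h.1.le.trans h.2)]
          linarith [h.1]
    have ht : Tendsto (fun φ : 𝓢(E, ℂ) => P (Laplacian.laplacian φ) * |s - 0|) (𝓝 0) (𝓝 0) := by
      have hc : Continuous fun φ : 𝓢(E, ℂ) => P (Laplacian.laplacian φ) * |s - 0| :=
        (hP.comp continuous_laplacian).mul continuous_const
      have h0 : (Laplacian.laplacian (0 : 𝓢(E, ℂ)) : 𝓢(E, ℂ)) = 0 := by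
        simp only [← SchwartzMap.laplacianCLM_eq (𝕜 := ℂ), map_zero]
      have := hc.tendsto 0
      rwa [h0, map_zero, zero_mul] at this
    rw [ContinuousAt, map_zero]
    exact squeeze_zero_norm hle ht
  exact ⟨ContinuousLinearMap.toPointwiseConvergenceCLM _ _ _ _ ⟨L, hL⟩, fun φ => rfl⟩

section

variable {p : ℝ → 𝓢'(E, ℂ)} {f : 𝓢'(E, ℂ)}

theorem IsDistributionalWaveSolution.continuous_abs (hp : IsDistributionalWaveSolution p f)
    (φ : 𝓢(E, ℂ)) : Continuous fun s => p |s| φ := by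
  have h : ContinuousOn (fun t => p t φ) (Set.Ici 0) := by
    intro t ht
    rcases (Set.mem_Ici.1 ht).eq_or_lt with h | h
    · rw [← h]
      exact (hp.initial_velocity φ).continuousWithinAt
    · exact (hp.differentiable φ t h).continuousAt.continuousWithinAt
  exact h.comp_continuous _root_.continuous_abs fun s => abs_nonneg s

/-- The velocity minus the integral has zero derivative on `(0, ∞)`, hence is a constant `c`. No
limit of the velocity at `0` is assumed, but `c` is that limit, so it equals the one-sided
derivative at `0`, which is `0`. -/
theorem IsDistributionalWaveSolution.hasDerivAt_of_pos (hp : IsDistributionalWaveSolution p f)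
    (φ : 𝓢(E, ℂ)) {t : ℝ} (ht : 0 < t) :
    HasDerivAt (fun t => p t φ) (∫ σ in (0 : ℝ)..t, p |σ| (Laplacian.laplacian φ)) t := by
  set y := fun t => p t φ with hy
  set g := fun σ => p |σ| (Laplacian.laplacian φ) with hg
  have hgc : Continuous g := hp.continuous_abs _
  set G := fun t => ∫ σ in (0 : ℝ)..t, g σ with hG
  have hGd : ∀ t, HasDerivAt G (g t) t := fun t => hgc.integral_hasStrictDerivAt 0 t |>.hasDerivAt
  have hd : ∀ t, 0 < t → HasDerivAt (fun t => deriv y t - G t) 0 t := by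
    intro t ht
    have h1 := (hp.wave φ t ht).fun_sub (hGd t)
    have h2 : Laplacian.laplacian (p t) φ - g t = 0 := by
      simp only [TemperedDistribution.laplacian_apply_apply, hg, abs_of_pos ht, sub_self]
    rwa [h2] at h1
  obtain ⟨c, hc⟩ := isOpen_Ioi.exists_is_const_of_deriv_eq_zero (convex_Ioi (0 : ℝ)).isPreconnected
    (fun t ht => (hd t ht).differentiableAt.differentiableWithinAt) (fun t ht => (hd t ht).deriv)
  have hlim : Tendsto (fun t => deriv y t) (𝓝[>] 0) (𝓝 c) := by
    have h1 : Tendsto (fun t => G t + c) (𝓝[>] 0) (𝓝 c) := by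
      have := ((hGd 0).continuousAt.add (continuousAt_const (y := c))).tendsto
      have e : G 0 = 0 := intervalIntegral.integral_same
      simp only [Pi.add_apply, e, zero_add] at this
      exact this.mono_left nhdsWithin_le_nhds
    refine h1.congr' ?_
    filter_upwards [self_mem_nhdsWithin] with t ht
    rw [← hc t ht]
    ring
  have h0 : HasDerivWithinAt y c (Set.Ici 0) 0 :=
    hasDerivWithinAt_Ici_of_tendsto_deriv
      (fun t ht => (hp.differentiable φ t ht).differentiableWithinAt)
      ((hp.initial_velocity φ).continuousWithinAt.mono Set.Ioi_subset_Ici_self)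
      self_mem_nhdsWithin hlim
  have hc0 : c = 0 := (uniqueDiffWithinAt_Ici (0 : ℝ)).eq_deriv _ h0 (hp.initial_velocity φ)
  have e := hc t ht
  rw [hc0, sub_eq_zero] at e
  have := (hp.differentiable φ t ht).hasDerivAt
  rwa [show deriv (fun s => p s φ) t = G t from e] at this

theorem IsDistributionalWaveSolution.hasDerivAt_abs (hp : IsDistributionalWaveSolution p f)
    (φ : 𝓢(E, ℂ)) (s : ℝ) :
    HasDerivAt (fun s => p |s| φ) (∫ σ in (0 : ℝ)..s, p |σ| (Laplacian.laplacian φ)) s := by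
  rcases lt_trichotomy s 0 with h | h | h
  · have h1 := (hp.hasDerivAt_of_pos φ (neg_pos.2 h)).scomp s (hasDerivAt_neg s)
    have e : (-1 : ℝ) • ∫ σ in (0 : ℝ)..-s, p |σ| (Laplacian.laplacian φ) =
        ∫ σ in (0 : ℝ)..s, p |σ| (Laplacian.laplacian φ) := by
      have := intervalIntegral.integral_comp_neg (a := 0) (b := s)
        (fun σ => p |σ| (Laplacian.laplacian φ))
      simp only [abs_neg, neg_zero] at this
      rw [this, intervalIntegral.integral_symm]
      simp
    rw [e] at h1
    refine h1.congr_of_eventuallyEq ?_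
    filter_upwards [eventually_lt_nhds h] with t ht
    simp [abs_of_neg ht]
  · subst h
    rw [intervalIntegral.integral_same]
    have h1 : HasDerivWithinAt (fun s => p |s| φ) 0 (Set.Ici 0) 0 :=
      (hp.initial_velocity φ).congr (fun t ht => by rw [abs_of_nonneg ht]) (by simp)
    have h2 : HasDerivWithinAt (fun s => p |s| φ) 0 (Set.Iic 0) 0 := by
      have hn : HasDerivWithinAt (fun s : ℝ => -s) (-1) (Set.Iic 0) 0 :=
        (hasDerivAt_neg (0 : ℝ)).hasDerivWithinAt
      have hv : HasDerivWithinAt (fun t => p t φ) 0 (Set.Ici 0) (-0) := by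
        rw [neg_zero]
        exact hp.initial_velocity φ
      have := hv.scomp (0 : ℝ) hn (fun t ht => by simpa using ht)
      simp only [smul_zero] at this
      refine this.congr (fun t ht => ?_) (by simp)
      simp [abs_of_nonpos (Set.mem_Iic.1 ht)]
    have := h1.union h2
    rwa [Set.Ici_union_Iic, hasDerivWithinAt_univ] at this
  · refine (hp.hasDerivAt_of_pos φ h).congr_of_eventuallyEq ?_
    filter_upwards [eventually_gt_nhds h] with t ht
    rw [abs_of_pos ht]

/-- The even extension in time of a distributional solution of the wave equation. -/
theorem IsDistributionalWaveSolution.exists_isWavePair (hp : IsDistributionalWaveSolution p f) :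
    ∃ q' : ℝ → 𝓢'(E, ℂ), IsWavePair (fun s => p |s|) q' ∧ ∀ φ, q' 0 φ = 0 := by
  choose q' hq' using exists_timePrimitive_laplacian (q := fun s => p |s|) hp.continuous_abs
  refine ⟨q', ⟨fun φ s => ?_, fun φ s => ?_⟩, fun φ => by rw [hq', intervalIntegral.integral_same]⟩
  · rw [hq']
    exact hp.hasDerivAt_abs φ s
  · simp only [hq', TemperedDistribution.laplacian_apply_apply]
    exact ((hp.continuous_abs (Laplacian.laplacian φ)).integral_hasStrictDerivAt 0 s).hasDerivAt

end

end Photoacoustic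
end

noncomputable section

namespace Photoacoustic

open Filter MeasureTheory Complex

/-! ### Superpositions of plane waves -/

section Moments

variable {D : Type*} [NormedAddCommGroup D] [MeasureSpace D]

/-- A continuous function with integrable moments of all orders. -/
structure HasMoments (h : D → ℂ) : Prop where
  continuous : Continuous h
  integrable : ∀ n : ℕ, Integrable fun k => ‖k‖ ^ n * ‖h k‖

variable [BorelSpace D]

theorem HasMoments.integrable_self {h : D → ℂ} (hh : HasMoments h) : Integrable h := by
  have := hh.integrable 0
  simp only [pow_zero, one_mul] at this
  exact (integrable_norm_iff hh.continuous.aestronglyMeasurable).1 this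

theorem HasMoments.mul {h m : D → ℂ} (hh : HasMoments h) (hm : Continuous m) {C : ℝ} {N : ℕ}
    (hC : ∀ k, ‖m k‖ ≤ C * ‖k‖ ^ N) : HasMoments fun k => m k * h k where
  continuous := hm.mul hh.continuous
  integrable n := by
    refine ((hh.integrable (n + N)).const_mul C).mono'
      ((continuous_norm.pow n).mul (hm.mul hh.continuous).norm).aestronglyMeasurable
      (Eventually.of_forall fun k => ?_)
    rw [Real.norm_of_nonneg (by positivity), norm_mul]
    calc ‖k‖ ^ n * (‖m k‖ * ‖h k‖) ≤ ‖k‖ ^ n * (C * ‖k‖ ^ N * ‖h k‖) := by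
          gcongr
          exact hC k
      _ = _ := by rw [pow_add]; ring

theorem norm_planeWave (θ : ℝ) (c : ℂ) : ‖cexp ((θ : ℝ) * I) * c‖ = ‖c‖ := by
  rw [norm_mul, norm_exp_ofReal_mul_I, one_mul]

theorem hasFDerivAt_planeWave {W : Type*} [NormedAddCommGroup W] [NormedSpace ℝ W]
    (l : W →L[ℝ] ℝ) (c : ℂ) (x : W) :
    HasFDerivAt (fun x => cexp ((2 * Real.pi * l x : ℝ) * I) * c)
      (l.smulRight (cexp ((2 * Real.pi * l x : ℝ) * I) * ((2 * Real.pi * I) * c))) x := by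
  have h1 : HasFDerivAt (fun x => ((2 * Real.pi * l x : ℝ) : ℂ)) _ x :=
    (ofRealCLM.hasFDerivAt (x := 2 * Real.pi * l x)).comp x
      ((l.hasFDerivAt (x := x)).const_mul (2 * Real.pi))
  refine ((h1.mul_const I).cexp.mul_const c).congr_fderiv ?_
  ext v
  simp
  ring

/-- The superposition of the plane waves with phases `l k` and spectral density `h`. -/
def superposition {W : Type*} [NormedAddCommGroup W] [NormedSpace ℝ W] (l : D → W →L[ℝ] ℝ)
    (h : D → ℂ) (x : W) : ℂ :=
  ∫ k, cexp ((2 * Real.pi * l k x : ℝ) * I) * h k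

section

variable {W : Type*} [NormedAddCommGroup W] [NormedSpace ℝ W] {l : D → W →L[ℝ] ℝ}

theorem integrable_planeWave (hl : Continuous l) {h : D → ℂ} (hh : HasMoments h) (x : W) :
    Integrable fun k => cexp ((2 * Real.pi * l k x : ℝ) * I) * h k := by
  refine hh.integrable_self.mono ?_ (Eventually.of_forall fun k => (norm_planeWave _ _).le)
  have := hh.continuous
  exact Continuous.aestronglyMeasurable (by fun_prop)

theorem hasFDerivAt_superposition [SecondCountableTopology D] (hl : Continuous l) {C : ℝ} (hC : ∀ k, ‖l k‖ ≤ C * ‖k‖)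
    {h : D → ℂ} (hh : HasMoments h) (x : W) :
    Integrable (fun k => (l k).smulRight
      (cexp ((2 * Real.pi * l k x : ℝ) * I) * ((2 * Real.pi * I) * h k))) ∧
    HasFDerivAt (superposition l h)
      (∫ k, (l k).smulRight
        (cexp ((2 * Real.pi * l k x : ℝ) * I) * ((2 * Real.pi * I) * h k))) x := by
  have hhc := hh.continuous
  have hm : ∀ x, Continuous fun k => (l k).smulRight
      (cexp ((2 * Real.pi * l k x : ℝ) * I) * ((2 * Real.pi * I) * h k)) := by
    intro x
    have h1 : Continuous fun k =>
        cexp ((2 * Real.pi * l k x : ℝ) * I) * ((2 * Real.pi * I) * h k) := by fun_prop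
    exact ((ContinuousLinearMap.smulRightL ℝ W ℂ).continuous.comp hl).clm_apply h1
  have hbound : ∀ (x : W) (k : D), ‖(l k).smulRight
      (cexp ((2 * Real.pi * l k x : ℝ) * I) * ((2 * Real.pi * I) * h k))‖ ≤
        C * (2 * Real.pi) * (‖k‖ ^ 1 * ‖h k‖) := by
    intro x k
    rw [ContinuousLinearMap.norm_smulRight_apply, norm_planeWave]
    have h2 : ‖(2 * Real.pi * I : ℂ) * h k‖ = 2 * Real.pi * ‖h k‖ := by
      simp [abs_of_pos Real.pi_pos]
    rw [h2]
    calc _ ≤ C * ‖k‖ * (2 * Real.pi * ‖h k‖) := by gcongr; exact hC k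
      _ = _ := by ring
  have hbi : Integrable fun k => C * (2 * Real.pi) * (‖k‖ ^ 1 * ‖h k‖) :=
    (hh.integrable 1).const_mul _
  refine ⟨hbi.mono' (hm x).aestronglyMeasurable (Eventually.of_forall (hbound x)), ?_⟩
  exact hasFDerivAt_integral_of_dominated_of_fderiv_le (𝕜 := ℝ) (s := Set.univ)
    (F := fun x k => cexp ((2 * Real.pi * l k x : ℝ) * I) * h k)
    (F' := fun x k => (l k).smulRight
      (cexp ((2 * Real.pi * l k x : ℝ) * I) * ((2 * Real.pi * I) * h k)))
    Filter.univ_mem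
    (Eventually.of_forall fun y => (integrable_planeWave hl hh y).aestronglyMeasurable)
    (integrable_planeWave hl hh x) (hm x).aestronglyMeasurable
    (Eventually.of_forall fun k y _ => hbound y k) hbi
    (Eventually.of_forall fun k y _ => hasFDerivAt_planeWave _ _ _)

theorem HasMoments.phase_mul (hl : Continuous l) {C : ℝ} (hC : ∀ k, ‖l k‖ ≤ C * ‖k‖)
    {h : D → ℂ} (hh : HasMoments h) (v : W) :
    HasMoments fun k => (2 * Real.pi * I * l k v) * h k := by
  refine hh.mul (C := 2 * Real.pi * C * ‖v‖) (N := 1) (by fun_prop) fun k => ?_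
  have h1 := (l k).le_opNorm v
  have h3 : ‖(2 * Real.pi * I * l k v : ℂ)‖ = 2 * Real.pi * ‖l k v‖ := by
    simp [abs_of_pos Real.pi_pos]
  rw [h3]
  calc _ ≤ 2 * Real.pi * (C * ‖k‖ * ‖v‖) := by
        gcongr
        exact h1.trans (by gcongr; exact hC k)
    _ = _ := by ring

theorem fderiv_superposition_apply [SecondCountableTopology D] (hl : Continuous l) {C : ℝ} (hC : ∀ k, ‖l k‖ ≤ C * ‖k‖)
    {h : D → ℂ} (hh : HasMoments h) (x v : W) :
    fderiv ℝ (superposition l h) x v =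
      superposition l (fun k => (2 * Real.pi * I * l k v) * h k) x := by
  obtain ⟨hi, hd⟩ := hasFDerivAt_superposition hl hC hh x
  rw [hd.fderiv, ContinuousLinearMap.integral_apply hi, superposition]
  congr 1 with k
  simp
  ring

/-- Differentiation multiplies the spectral density by a factor of linear growth, which preserves
`HasMoments`, so the induction runs over all such densities. -/
theorem contDiff_superposition [SecondCountableTopology D] [FiniteDimensional ℝ W] (hl : Continuous l) {C : ℝ}
    (hC : ∀ k, ‖l k‖ ≤ C * ‖k‖) (n : ℕ) :
    ∀ {h : D → ℂ} (_ : HasMoments h), ContDiff ℝ n (superposition l h) := by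
  induction n with
  | zero =>
    exact fun hh => contDiff_zero.2 (continuous_iff_continuousAt.2 fun x =>
      (hasFDerivAt_superposition hl hC hh x).2.continuousAt)
  | succ n ih =>
    intro h hh
    push_cast
    refine contDiff_succ_iff_hasFDerivAt.2 ⟨fderiv ℝ (superposition l h), ?_, fun x =>
      (hasFDerivAt_superposition hl hC hh x).2.differentiableAt.hasFDerivAt⟩
    refine contDiff_clm_apply_iff.2 fun v => ?_
    simp only [fderiv_superposition_apply hl hC hh]
    exact ih (hh.phase_mul hl hC v)

end

end Moments

/-! ### Plane waves and the dispersion relation -/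

section Wave

variable {D E : Type*} [NormedAddCommGroup D] [InnerProductSpace ℝ D]
  [NormedAddCommGroup E] [InnerProductSpace ℝ E]

/-- The phase of the plane wave with wave vector `j k`, travelling in direction `σ`. -/
def wavePhase (j : D →L[ℝ] E) (σ : ℝ) (k : D) : E × ℝ →L[ℝ] ℝ :=
  (innerSL ℝ (j k)).comp (ContinuousLinearMap.fst ℝ E ℝ) +
    (σ * ‖k‖) • ContinuousLinearMap.snd ℝ E ℝ

theorem wavePhase_apply (j : D →L[ℝ] E) (σ : ℝ) (k : D) (x : E × ℝ) :
    wavePhase j σ k x = inner ℝ (j k) x.1 + σ * ‖k‖ * x.2 := rfl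

theorem continuous_wavePhase (j : D →L[ℝ] E) (σ : ℝ) : Continuous (wavePhase j σ) := by
  unfold wavePhase
  refine Continuous.add ?_ ?_
  · exact (((innerSL ℝ).continuous.comp j.continuous).clm_comp continuous_const)
  · fun_prop

theorem norm_wavePhase_le {j : D →L[ℝ] E} (hj : ∀ k, ‖j k‖ = ‖k‖) {σ : ℝ} (hσ : σ ^ 2 = 1) (k : D) :
    ‖wavePhase j σ k‖ ≤ 2 * ‖k‖ := by
  have hσ1 : |σ| ≤ 1 := by rw [← sq_le_one_iff_abs_le_one, hσ]
  refine ContinuousLinearMap.opNorm_le_bound _ (by positivity) fun x => ?_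
  rw [wavePhase_apply]
  have h1 : ‖(inner ℝ (j k) x.1 : ℝ)‖ ≤ ‖k‖ * ‖x‖ := by
    rw [← hj k]
    exact (norm_inner_le_norm _ _).trans (by gcongr; exact norm_fst_le x)
  have h2 : ‖σ * ‖k‖ * x.2‖ ≤ ‖k‖ * ‖x‖ := by
    rw [norm_mul, norm_mul, norm_norm, Real.norm_eq_abs σ]
    calc |σ| * ‖k‖ * ‖x.2‖ ≤ 1 * ‖k‖ * ‖x‖ := by gcongr; exact norm_snd_le x
      _ = _ := by rw [one_mul]
  calc _ ≤ _ := norm_add_le _ _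
    _ ≤ _ := by linarith

variable [FiniteDimensional ℝ D] [MeasurableSpace D] [BorelSpace D]

theorem HasMoments.of_schwartz (h : 𝓢(D, ℂ)) : HasMoments h where
  continuous := h.continuous
  integrable n := h.integrable_pow_mul volume n

/-- Dispersion relation: the squared time frequency `‖k‖²` equals the squared length of the wave
vector `j k`. Allowing an isometric `j` covers both planar waves (`j = id`) and `z`-independent
waves on `ℝ³` (`j = planeIncl`). -/
theorem isWaveFunction_superposition [FiniteDimensional ℝ E] {j : D →L[ℝ] E}
    (hj : ∀ k, ‖j k‖ = ‖k‖) {σ : ℝ} (hσ : σ ^ 2 = 1) {h : D → ℂ} (hh : HasMoments h) :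
    IsWaveFunction (superposition (wavePhase j σ) h) := by
  have hl := continuous_wavePhase j σ
  have hC := norm_wavePhase_le hj hσ
  have hc2 := contDiff_superposition hl hC 2 hh
  refine ⟨hc2, fun x => ?_⟩
  have key : ∀ v, iteratedFDeriv ℝ 2 (superposition (wavePhase j σ) h) x ![v, v] =
      superposition (wavePhase j σ) (fun k => (2 * Real.pi * I * wavePhase j σ k v) *
          ((2 * Real.pi * I * wavePhase j σ k v) * h k)) x := fun v => by
    rw [iteratedFDeriv_two_eq_fderiv_fderiv hc2]
    simp only [fderiv_superposition_apply hl hC hh]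
    rw [fderiv_superposition_apply hl hC (hh.phase_mul hl hC v)]
  simp only [key, superposition]
  rw [← integral_finsetSum _ fun i _ =>
    integrable_planeWave hl ((hh.phase_mul hl hC _).phase_mul hl hC _) x]
  congr 1 with k
  have h1 : ∑ i, (wavePhase j σ k (stdOrthonormalBasis ℝ E i, 0)) ^ 2 = ‖k‖ ^ 2 := by
    rw [← hj k, ← (stdOrthonormalBasis ℝ E).sum_sq_inner_left]
    simp [wavePhase_apply]
  have h2 : (wavePhase j σ k (0, 1)) ^ 2 = ‖k‖ ^ 2 := by
    rw [wavePhase_apply]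
    simp only [inner_zero_right, zero_add, mul_one, mul_pow, hσ, one_mul]
  rw [← h1] at h2
  have h3 := congrArg (fun r : ℝ => (r : ℂ)) h2
  push_cast at h3
  calc _ = cexp ((2 * Real.pi * wavePhase j σ k x : ℝ) * I) * ((2 * Real.pi * I) ^ 2 *
          (wavePhase j σ k (0, 1) : ℂ) ^ 2 * h k) := by ring
    _ = _ := by
        rw [h3, Finset.mul_sum, Finset.sum_mul, Finset.mul_sum]
        exact Finset.sum_congr rfl fun i _ => by ring

end Wave

end Photoacoustic
end

noncomputable section

namespace Photoacoustic

open Filter MeasureTheory Complex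

/-! ### Time-even waves and standing waves -/

section

variable {E F : Type*} [NormedAddCommGroup E] [InnerProductSpace ℝ E]
  [NormedAddCommGroup F] [NormedSpace ℝ F]

theorem fderiv_time_eq_zero_of_even {u : E × ℝ → F} (hu : Differentiable ℝ u)
    (heven : ∀ a s, u (a, -s) = u (a, s)) (a : E) : fderiv ℝ u (a, 0) (0, 1) = 0 := by
  have h1 : HasDerivAt (fun s => u (a, s)) (fderiv ℝ u (a, 0) (0, 1)) 0 := by
    have := (hu (a, 0)).hasFDerivAt.comp (0 : ℝ) (hasFDerivAt_prodMk_right a (0 : ℝ))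
    simpa using! this.hasDerivAt
  have h2 : HasDerivAt (fun s => u (a, s)) (-fderiv ℝ u (a, 0) (0, 1)) 0 := by
    have h3 : HasDerivAt (fun s => u (a, s)) (fderiv ℝ u (a, 0) (0, 1)) (-0) := by rwa [neg_zero]
    have := h3.scomp (0 : ℝ) (hasDerivAt_neg (0 : ℝ))
    rw [neg_one_smul] at this
    refine this.congr_of_eventuallyEq (Eventually.of_forall fun s => ?_)
    exact (heven a s).symm
  have h := h1.unique h2
  rw [eq_neg_iff_add_eq_zero, ← two_smul ℝ] at h
  exact (smul_eq_zero.1 h).resolve_left two_ne_zero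

variable [FiniteDimensional ℝ E]

theorem IsWaveFunction.comp_add {u : E × ℝ → F} (hu : IsWaveFunction u) (ξ : E) :
    IsWaveFunction fun x => u (x + (ξ, 0)) where
  contDiff := hu.contDiff.comp (contDiff_id.add contDiff_const)
  wave x := by
    simp only [iteratedFDeriv_comp_add_right]
    exact hu.wave _

theorem IsWaveFunction.eq_zero_of_even {u : E × ℝ → ℝ} (hu : IsWaveFunction u)
    (heven : ∀ a s, u (a, -s) = u (a, s)) {T : ℝ} (hT : 0 ≤ T)
    (h0 : ∀ a, ‖a‖ < T + 2 → u (a, 0) = 0) : u (0, T) = 0 :=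
  hu.eq_zero_of_cauchyData hT h0 fun a _ =>
    fderiv_time_eq_zero_of_even (hu.contDiff.differentiable two_ne_zero) heven a

/-- Two time-even complex `C²` solutions of the wave equation which agree at time `0` on the ball
of radius `T + 2` agree at `(0, T)`. -/
theorem IsWaveFunction.eq_of_even {u v : E × ℝ → ℂ} (hu : IsWaveFunction u) (hv : IsWaveFunction v)
    (hu' : ∀ a s, u (a, -s) = u (a, s)) (hv' : ∀ a s, v (a, -s) = v (a, s)) {T : ℝ} (hT : 0 ≤ T)
    (h0 : ∀ a, ‖a‖ < T + 2 → u (a, 0) = v (a, 0)) : u (0, T) = v (0, T) := by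
  have h := hu.sub hv
  rw [← sub_eq_zero]
  apply Complex.ext
  · exact (h.clm_comp reCLM).eq_zero_of_even (fun a s => by simp only [hu', hv']) hT
      fun a ha => by simp [h0 a ha]
  · exact (h.clm_comp imCLM).eq_zero_of_even (fun a s => by simp only [hu', hv']) hT
      fun a ha => by simp [h0 a ha]

theorem IsWaveFunction.iteratedDeriv_two {u : E × ℝ → F} (hu : IsWaveFunction u) (x : E) (t : ℝ) :
    iteratedDeriv 2 (fun s => u (x, s)) t = Laplacian.laplacian (fun y => u (y, t)) x := by
  have hd := hu.contDiff.differentiable two_ne_zero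
  have hd1 : ∀ w, Differentiable ℝ fun y => fderiv ℝ u y w := fun w =>
    ((hu.contDiff.fderiv_right (m := 1) (by norm_num)).clm_apply contDiff_const).differentiable
      one_ne_zero
  have ht : ∀ {g : E × ℝ → F}, Differentiable ℝ g → ∀ s,
      HasDerivAt (fun s => g (x, s)) (fderiv ℝ g (x, s) (0, 1)) s := fun hg s => by
    have := (hg (x, s)).hasFDerivAt.comp s (hasFDerivAt_prodMk_right x s)
    simpa using! this.hasDerivAt
  have hx : ∀ {g : E × ℝ → F}, Differentiable ℝ g → ∀ y v,
      fderiv ℝ (fun y => g (y, t)) y v = fderiv ℝ g (y, t) (v, 0) := fun hg y v => by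
    have h : HasFDerivAt (fun y => _) _ y := (hg (y, t)).hasFDerivAt.comp (𝕜 := ℝ) y
      (hasFDerivAt_prodMk_left y t)
    exact (DFunLike.congr_fun h.fderiv v).trans (by simp)
  have h1 : iteratedDeriv 2 (fun s => u (x, s)) t = iteratedFDeriv ℝ 2 u (x, t) ![(0, 1), (0, 1)] := by
    rw [iteratedFDeriv_two_eq_fderiv_fderiv hu.contDiff, iteratedDeriv_succ, iteratedDeriv_one]
    have : deriv (fun s => u (x, s)) = fun s => fderiv ℝ u (x, s) (0, 1) :=
      funext fun s => (ht hd s).deriv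
    rw [this]
    exact (ht (hd1 _) t).deriv
  have hc : ContDiff ℝ 2 fun y => u (y, t) := hu.contDiff.comp (contDiff_id.prodMk contDiff_const)
  rw [h1, hu.wave, InnerProductSpace.laplacian_eq_iteratedFDeriv_stdOrthonormalBasis]
  refine Finset.sum_congr rfl fun i _ => ?_
  rw [iteratedFDeriv_two_eq_fderiv_fderiv hu.contDiff, iteratedFDeriv_two_eq_fderiv_fderiv hc]
  simp only [hx hd]
  exact (hx (hd1 _) x _).symm

end

section StandingWave

variable {D E : Type*} [NormedAddCommGroup D] [InnerProductSpace ℝ D] [FiniteDimensional ℝ D]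
  [MeasurableSpace D] [BorelSpace D] [NormedAddCommGroup E] [InnerProductSpace ℝ E]

/-- The standing wave `∫ exp(2πi ⟪j k, a⟫) cos(2π |k| s) h(k) dk`. -/
def standingWave (j : D →L[ℝ] E) (h : D → ℂ) (x : E × ℝ) : ℂ :=
  (2⁻¹ : ℂ) * (superposition (wavePhase j 1) h x + superposition (wavePhase j (-1)) h x)

theorem superposition_neg (j : D →L[ℝ] E) (σ : ℝ) (h : D → ℂ) (a : E) (s : ℝ) :
    superposition (wavePhase j σ) h (a, -s) = superposition (wavePhase j (-σ)) h (a, s) := by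
  simp only [superposition, wavePhase_apply, neg_mul, mul_neg]

theorem standingWave_neg (j : D →L[ℝ] E) (h : D → ℂ) (a : E) (s : ℝ) :
    standingWave j h (a, -s) = standingWave j h (a, s) := by
  simp only [standingWave, superposition_neg, neg_neg]
  ring

theorem standingWave_zero (j : D →L[ℝ] E) (h : D → ℂ) (a : E) :
    standingWave j h (a, 0) = ∫ k, cexp ((2 * Real.pi * inner ℝ (j k) a : ℝ) * I) * h k := by
  simp only [standingWave, superposition, wavePhase_apply, mul_zero, add_zero]
  ring

theorem isWaveFunction_standingWave [FiniteDimensional ℝ E] {j : D →L[ℝ] E}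
    (hj : ∀ k, ‖j k‖ = ‖k‖) {h : D → ℂ} (hh : HasMoments h) :
    IsWaveFunction (standingWave j h) :=
  ((isWaveFunction_superposition hj (by norm_num) hh).add
    (isWaveFunction_superposition hj (by norm_num) hh)).clm_comp
      (ContinuousLinearMap.mul ℝ ℂ 2⁻¹)

end StandingWave

/-! ### The vertically integrated pressure -/

section Pressure

open FourierTransform

variable (f : Plane → ℝ) (hf : ContDiff ℝ ∞ f) (hc : HasCompactSupport f)

/-- The complex-valued solution of the two-dimensional wave equation with initial data `(f, 0)`. -/
def planarPressure (x : Plane × ℝ) : ℂ :=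
  standingWave (ContinuousLinearMap.id ℝ Plane) (𝓕 (complexTest f hf hc) : 𝓢(Plane, ℂ)) x

theorem isWaveFunction_planarPressure : IsWaveFunction (planarPressure f hf hc) :=
  isWaveFunction_standingWave (fun _ => rfl) (HasMoments.of_schwartz _)

theorem planarPressure_neg (ξ : Plane) (t : ℝ) :
    planarPressure f hf hc (ξ, -t) = planarPressure f hf hc (ξ, t) :=
  standingWave_neg _ _ _ _

theorem complexTest_apply (ξ : Plane) : complexTest f hf hc ξ = (f ξ : ℂ) := rfl

theorem planarPressure_zero (ξ : Plane) : planarPressure f hf hc (ξ, 0) = f ξ := by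
  rw [planarPressure, standingWave_zero, ← complexTest_apply f hf hc]
  have h : (𝓕⁻ (𝓕 (complexTest f hf hc))) ξ = complexTest f hf hc ξ := by
    rw [FourierTransform.fourierInv_fourier_eq]
  rw [← h, SchwartzMap.fourierInv_coe, Real.fourierInv_eq']
  rfl

/-- The imaginary part is a time-even wave with zero initial value, so uniqueness applies. -/
theorem planarPressure_im (ξ : Plane) (t : ℝ) : (planarPressure f hf hc (ξ, t)).im = 0 := by
  have key : ∀ t, 0 ≤ t → (planarPressure f hf hc (ξ, t)).im = 0 := by
    intro t ht
    have := (((isWaveFunction_planarPressure f hf hc).comp_add ξ).clm_comp imCLM).eq_zero_of_even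
      (T := t) (fun a s => ?_) ht fun a _ => ?_
    · simpa using this
    · simp only [Prod.mk_add_mk, add_zero, planarPressure_neg]
    · simp only [Prod.mk_add_mk, add_zero, planarPressure_zero, imCLM_apply, ofReal_im]
  rcases le_total 0 t with h | h
  · exact key t h
  · rw [← planarPressure_neg]
    exact key (-t) (neg_nonneg.2 h)

/-- The solution of the two-dimensional wave equation with initial data `(f, 0)`. -/
def pressure (x : Plane × ℝ) : ℝ := (planarPressure f hf hc x).re

theorem ofReal_pressure (x : Plane × ℝ) : (pressure f hf hc x : ℂ) = planarPressure f hf hc x :=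
  Complex.ext (by simp [pressure]) (by simpa using (planarPressure_im f hf hc x.1 x.2).symm)

theorem isWaveFunction_pressure : IsWaveFunction (pressure f hf hc) :=
  (isWaveFunction_planarPressure f hf hc).clm_comp reCLM

theorem pressure_neg (ξ : Plane) (t : ℝ) : pressure f hf hc (ξ, -t) = pressure f hf hc (ξ, t) := by
  simp only [pressure, planarPressure_neg]

theorem pressure_zero (ξ : Plane) : pressure f hf hc (ξ, 0) = f ξ := by
  simp [pressure, planarPressure_zero]

theorem continuous_pressure : Continuous (pressure f hf hc) :=
  (isWaveFunction_pressure f hf hc).contDiff.continuous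

/-- `P` is constrained only for `t ≥ 0`. Its regularity up to time `0` is inherited from `pressure`,
which is `C²` on the whole time axis and has zero initial velocity because it is even. -/
theorem isClassicalWaveSolution_of_eq_pressure {P : Plane → ℝ → ℝ}
    (hP : ∀ ξ t, 0 ≤ t → P ξ t = pressure f hf hc (ξ, t)) : IsClassicalWaveSolution P f where
  smooth := (isWaveFunction_pressure f hf hc).contDiff.contDiffOn.congr
    fun x hx => hP x.1 x.2 hx.2
  wave x t ht := by
    have h1 : (fun s => P x s) =ᶠ[𝓝 t] fun s => pressure f hf hc (x, s) := by
      filter_upwards [eventually_ge_nhds ht] with s hs using hP x s hs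
    have h2 : (fun y => P y t) = fun y => pressure f hf hc (y, t) := funext fun y => hP y t ht.le
    rw [h1.iteratedDeriv_eq, h2]
    exact (isWaveFunction_pressure f hf hc).iteratedDeriv_two x t
  initial_value x := by rw [hP x 0 le_rfl, pressure_zero]
  initial_velocity x := by
    have hd := (isWaveFunction_pressure f hf hc).contDiff.differentiable two_ne_zero
    have h0 := fderiv_time_eq_zero_of_even hd (pressure_neg f hf hc) x
    have := (hd (x, 0)).hasFDerivAt.comp (0 : ℝ) (hasFDerivAt_prodMk_right x (0 : ℝ))
    have h1 : HasDerivAt (fun s => pressure f hf hc (x, s))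
        (fderiv ℝ (pressure f hf hc) (x, 0) (0, 1)) 0 := by
      simpa using! this.hasDerivAt
    rw [h0] at h1
    exact h1.hasDerivWithinAt.congr (fun s hs => hP x s hs) (hP x 0 le_rfl)

end Pressure

end Photoacoustic
end

noncomputable section

namespace Photoacoustic

open Filter MeasureTheory Complex FourierTransform

/-! ### The vertical integral of a distributional solution -/

theorem norm_planeIncl (ξ : Plane) : ‖planeIncl ξ‖ = ‖ξ‖ := by
  rw [planeIncl_apply]
  simp

theorem inner_planeIncl (ξ : Plane) (a : Space3) :
    (inner ℝ (planeIncl ξ) a : ℝ) = inner ℝ ξ a.fst := by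
  rw [planeIncl_apply]
  simp

theorem hasMoments_fourierInv_mul (ψ h : 𝓢(Plane, ℂ)) :
    HasMoments fun k => (𝓕⁻ ψ : 𝓢(Plane, ℂ)) k * h k := by
  obtain ⟨C, -, hC⟩ := (𝓕⁻ ψ : 𝓢(Plane, ℂ)).decay 0 0
  exact (HasMoments.of_schwartz h).mul (N := 0) (𝓕⁻ ψ : 𝓢(Plane, ℂ)).continuous
    (C := C) fun k => by simpa using hC k

/-- Fubini: integrating `ψ(ζ)` against the factor `exp(2πi k · ζ)` of each plane wave multiplies the
density by `𝓕⁻ ψ`. This exhibits a planar wave averaged against `ψ` as a wave on `ℝ³`. -/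
theorem superposition_planeIncl (ψ h : 𝓢(Plane, ℂ)) (σ : ℝ) (a : Space3) (s : ℝ) :
    superposition (wavePhase planeIncl σ) (fun k => (𝓕⁻ ψ : 𝓢(Plane, ℂ)) k * h k) (a, s) =
      ∫ ζ, ψ ζ * superposition (wavePhase (ContinuousLinearMap.id ℝ Plane) σ) h
        (ζ + a.fst, s) := by
  have hint : Integrable (fun x : Plane × Plane => ψ x.1 *
      (cexp ((2 * Real.pi * wavePhase (ContinuousLinearMap.id ℝ Plane) σ x.2
        (x.1 + a.fst, s) : ℝ) * I) * h x.2)) (volume.prod volume) := by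
    have h0 : Integrable (fun x : Plane × Plane => ψ x.1 * h x.2) (volume.prod volume) :=
      ψ.integrable.mul_prod h.integrable
    refine h0.mono ?_ (Eventually.of_forall fun x => ?_)
    · have h1 := ψ.continuous
      have h2 := h.continuous
      refine Continuous.aestronglyMeasurable ?_
      simp only [wavePhase_apply]
      fun_prop
    · rw [norm_mul, norm_planeWave, norm_mul]
  simp only [superposition, ← integral_const_mul]
  rw [integral_integral_swap hint]
  congr 1 with k
  rw [SchwartzMap.fourierInv_coe, Real.fourierInv_eq', ← integral_mul_const, ← integral_const_mul]
  congr 1 with ζ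
  simp only [wavePhase_apply, inner_planeIncl, ContinuousLinearMap.id_apply, smul_eq_mul,
    inner_add_right, real_inner_comm k ζ]
  have : ((2 * Real.pi * (inner ℝ k ζ + inner ℝ k a.fst + σ * ‖k‖ * s) : ℝ) : ℂ) * I =
      ((2 * Real.pi * (inner ℝ k a.fst + σ * ‖k‖ * s) : ℝ) : ℂ) * I +
        ((2 * Real.pi * inner ℝ k ζ : ℝ) : ℂ) * I := by
    push_cast
    ring
  rw [this, Complex.exp_add]
  ring

section

variable (f : Plane → ℝ) (hf : ContDiff ℝ ∞ f) (hc : HasCompactSupport f)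

theorem integrable_mul_of_hasCompactSupport {X : Type*} [TopologicalSpace X] [MeasurableSpace X]
    [OpensMeasurableSpace X] [T2Space X] {μ : Measure X} [IsFiniteMeasureOnCompacts μ]
    {ψ g : X → ℂ} (hψ : Continuous ψ)
    (hψc : HasCompactSupport ψ) (hg : Continuous g) : Integrable (fun x => ψ x * g x) μ :=
  (hψ.mul hg).integrable_of_hasCompactSupport hψc.mul_right

theorem standingWave_planeIncl (ψ : 𝓢(Plane, ℂ)) (hψ : HasCompactSupport ψ) (a : Space3) (s : ℝ) :
    standingWave planeIncl (fun k => (𝓕⁻ ψ : 𝓢(Plane, ℂ)) k *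
        (𝓕 (complexTest f hf hc) : 𝓢(Plane, ℂ)) k) (a, s) =
      ∫ ζ, ψ ζ * planarPressure f hf hc (ζ + a.fst, s) := by
  have hcont : ∀ σ : ℝ, σ ^ 2 = 1 → Integrable fun ζ => ψ ζ *
      superposition (wavePhase (ContinuousLinearMap.id ℝ Plane) σ)
        (𝓕 (complexTest f hf hc) : 𝓢(Plane, ℂ)) (ζ + a.fst, s) := fun σ hσ =>
    integrable_mul_of_hasCompactSupport ψ.continuous hψ
      ((isWaveFunction_superposition (fun _ => rfl) hσ
        (HasMoments.of_schwartz _)).contDiff.continuous.comp (by fun_prop))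
  simp only [standingWave, planarPressure, superposition_planeIncl]
  rw [← integral_add (hcont 1 (by norm_num)) (hcont (-1) (by norm_num)), ← integral_const_mul]
  congr 1 with ζ
  ring

theorem abs_snd_le_norm (a : Space3) : |a.snd| ≤ ‖a‖ := by
  simpa using WithLp.norm_snd_le _ a

theorem planarSource_translate_testTensor (ψ : 𝓢(Plane, ℂ)) (hψ : HasCompactSupport ψ)
    (χ : 𝓢(ℝ, ℂ)) (hχ : HasCompactSupport χ) (a : Space3) (h1 : χ (-a.snd) = 1) :
    planarSource f hf hc ((testTensor ψ hψ χ hχ).compSubConstCLM ℂ a) =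
      ∫ ζ, ψ ζ * f (ζ + a.fst) := by
  rw [planarSource_apply]
  have h : ∀ ξ : Plane, ((testTensor ψ hψ χ hχ).compSubConstCLM ℂ a)
      (WithLp.toLp 2 (ξ, (0 : ℝ))) = ψ (ξ - a.fst) := fun ξ => by
    change ψ (ξ - a.fst) * χ (0 - a.snd) = _
    rw [zero_sub, h1, mul_one]
  simp only [h]
  rw [← integral_sub_right_eq_self (fun ζ => ψ ζ * (f (ζ + a.fst) : ℂ)) a.fst]
  simp only [sub_add_cancel]

/-- The translate pairing and the averaged planar wave are both time-even waves on `ℝ³`. At time `0`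
the pairing sees `χ` only at height `-a.snd`, where it is `1` for `‖a‖ < T + 2`; finite propagation
speed gives equality at `a = 0`, time `T`. -/
theorem pairing_testTensor_eq {p : ℝ → 𝓢'(Space3, ℂ)}
    (hp : IsDistributionalWaveSolution p (planarSource f hf hc)) {T : ℝ} (hT : 0 ≤ T)
    (ψ : 𝓢(Plane, ℂ)) (hψ : HasCompactSupport ψ) (χ : 𝓢(ℝ, ℂ)) (hχ : HasCompactSupport χ)
    (h1 : ∀ z, |z| ≤ T + 2 → χ z = 1) :
    p T (testTensor ψ hψ χ hχ) = ∫ ξ, ψ ξ * (pressure f hf hc (ξ, T) : ℂ) := by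
  obtain ⟨q', hq, -⟩ := hp.exists_isWavePair
  have key := (hq.isWaveFunction (testTensor ψ hψ χ hχ)).eq_of_even (T := T)
    (isWaveFunction_standingWave norm_planeIncl
      (hasMoments_fourierInv_mul ψ (𝓕 (complexTest f hf hc)))) ?_ (standingWave_neg _ _) hT ?_
  · rw [standingWave_planeIncl f hf hc ψ hψ] at key
    have h0 : (testTensor ψ hψ χ hχ).compSubConstCLM ℂ 0 = testTensor ψ hψ χ hχ := by
      ext x
      simp
    simp only [translatePairing, abs_of_nonneg hT] at key
    rw [h0] at key
    rw [key]
    simp [ofReal_pressure]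
  · intro a s
    simp only [translatePairing, abs_neg]
  · intro a ha
    rw [standingWave_planeIncl f hf hc ψ hψ]
    simp only [translatePairing, abs_zero, hp.initial_value, planarPressure_zero]
    refine planarSource_translate_testTensor f hf hc ψ hψ χ hχ a (h1 _ ?_)
    rw [abs_neg]
    exact (abs_snd_le_norm a).trans ha.le

theorem isVerticallyIntegrated_pressure {p : ℝ → 𝓢'(Space3, ℂ)}
    (hp : IsDistributionalWaveSolution p (planarSource f hf hc)) :
    IsVerticallyIntegrated p fun ξ t => pressure f hf hc (ξ, t) := by
  refine fun t ht => ⟨(continuous_pressure f hf hc).comp (by fun_prop), fun ψ hψ χ hχ => ?_⟩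
  refine tendsto_const_nhds.congr' ?_
  filter_upwards [hχ.eventually_one (t + 2)] with n hn
  exact (pairing_testTensor_eq f hf hc hp ht ψ hψ _ _ hn).symm

end

end Photoacoustic
end

noncomputable section

namespace Photoacoustic

open Filter MeasureTheory

/-! ### Approximate units and uniqueness of the vertical integral -/

/-- Dilates `χ₀(z / (n + 1))` of a bump equal to `1` on `[-1, 1]`: the `k`-th derivative is scaled
by `(n + 1)⁻ᵏ ≤ 1`. Without such a sequence the limit condition in `HasVerticalIntegral` would be
vacuous. -/
theorem exists_isApproximateUnit : ∃ χ : ℕ → 𝓢(ℝ, ℂ), IsApproximateUnit χ := by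
  let b : ContDiffBump (0 : ℝ) := ⟨1, 2, one_pos, one_lt_two⟩
  have hbc : HasCompactSupport fun z => (b z : ℂ) :=
    b.hasCompactSupport.comp_left (g := fun y : ℝ => (y : ℂ)) Complex.ofReal_zero
  let χ₀ : 𝓢(ℝ, ℂ) := hbc.toSchwartzMap (Complex.ofRealCLM.contDiff.comp b.contDiff)
  have hχ₀ : ∀ z, χ₀ z = (b z : ℂ) := fun z => rfl
  have hc : ∀ n : ℕ, HasCompactSupport fun z : ℝ => χ₀ ((n + 1 : ℝ)⁻¹ * z) := fun n =>
    (show HasCompactSupport χ₀ from hbc).comp_smul (c := (n + 1 : ℝ)⁻¹) (by positivity)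
  have hs : ∀ n : ℕ, ContDiff ℝ ∞ fun z : ℝ => χ₀ ((n + 1 : ℝ)⁻¹ * z) := fun n =>
    (χ₀.smooth ⊤).comp (contDiff_const.mul contDiff_id)
  refine ⟨fun n => (hc n).toSchwartzMap (hs n), hc, fun R => ?_, fun k => ?_⟩
  · filter_upwards [eventually_ge_atTop ⌈R⌉₊] with n hn z hz
    change χ₀ ((n + 1 : ℝ)⁻¹ * z) = 1
    rw [hχ₀, b.one_of_mem_closedBall, Complex.ofReal_one]
    rw [mem_closedBall_zero_iff, norm_mul, norm_inv, Real.norm_eq_abs z,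
      Real.norm_of_nonneg (by positivity)]
    change _ ≤ (1 : ℝ)
    rw [inv_mul_le_one₀ (by positivity)]
    have : (⌈R⌉₊ : ℝ) ≤ n := by exact_mod_cast hn
    linarith [Nat.le_ceil R]
  · obtain ⟨C, hC0, hC⟩ := χ₀.decay 0 k
    refine ⟨C, fun n z => ?_⟩
    change ‖iteratedDeriv k (fun z : ℝ => χ₀ ((n + 1 : ℝ)⁻¹ * z)) z‖ ≤ C
    rw [iteratedDeriv_comp_const_smul (χ₀.smooth k), norm_smul,
      ← norm_iteratedFDeriv_eq_norm_iteratedDeriv]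
    have h1 := hC ((n + 1 : ℝ)⁻¹ * z)
    rw [pow_zero, one_mul] at h1
    have h2 : ‖((n + 1 : ℝ)⁻¹) ^ k‖ ≤ 1 := by
      rw [norm_pow, norm_inv, Real.norm_of_nonneg (by positivity)]
      exact pow_le_one₀ (by positivity) (inv_le_one_of_one_le₀ (by simp))
    calc _ ≤ 1 * C := by gcongr
      _ = C := one_mul C

/-- Testing against all smooth compactly supported `ψ` gives equality almost everywhere, which
continuity upgrades to equality everywhere. -/
theorem HasVerticalIntegral.unique {T : 𝓢'(Space3, ℂ)} {g₁ g₂ : Plane → ℝ}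
    (h₁ : HasVerticalIntegral T g₁) (h₂ : HasVerticalIntegral T g₂) : g₁ = g₂ := by
  obtain ⟨χ, hχ⟩ := exists_isApproximateUnit
  rw [← Continuous.ae_eq_iff_eq volume h₁.1 h₂.1]
  refine ae_eq_of_integral_contDiff_smul_eq h₁.1.locallyIntegrable h₂.1.locallyIntegrable
    fun ψ hψ hψc => ?_
  have hc : HasCompactSupport (complexTest ψ hψ hψc) :=
    hψc.comp_left (g := fun y : ℝ => (y : ℂ)) Complex.ofReal_zero
  have := tendsto_nhds_unique (h₁.2 _ hc χ hχ) (h₂.2 _ hc χ hχ)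
  simp only [complexTest_apply, ← Complex.ofReal_mul] at this
  rw [integral_complex_ofReal, integral_complex_ofReal] at this
  exact Complex.ofReal_injective this

end Photoacoustic
end

noncomputable section

namespace Photoacoustic

open Filter MeasureTheory Set Real

/-! ### One-dimensional integrals -/

/-- The mean-type integral `∫₀^{π/2} g(τ sin φ) dφ`. -/
def sineIntegral (g : ℝ → ℝ) (τ : ℝ) : ℝ := ∫ φ in (0 : ℝ)..(π / 2), g (τ * sin φ)

theorem continuous_sineIntegral {g : ℝ → ℝ} (hg : Continuous g) : Continuous (sineIntegral g) :=
  intervalIntegral.continuous_parametric_intervalIntegral_of_continuous'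
    (by fun_prop) _ _

theorem image_sin_Ioo {r : ℝ} (hr : 0 < r) :
    (fun φ => r * sin φ) '' Ioo 0 (π / 2) = Ioo 0 r := by
  ext t
  constructor
  · rintro ⟨φ, ⟨h0, h1⟩, rfl⟩
    have hs : 0 < sin φ := sin_pos_of_pos_of_lt_pi h0 (by linarith [pi_pos])
    have hs1 : sin φ < 1 := by
      rw [← sin_pi_div_two]
      exact sin_lt_sin_of_lt_of_le_pi_div_two (by linarith) le_rfl h1
    exact ⟨by positivity, by nlinarith⟩
  · rintro ⟨h0, h1⟩
    have ht : 0 < t / r := by positivity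
    have ht1 : t / r < 1 := (div_lt_one hr).2 h1
    refine ⟨arcsin (t / r), ⟨arcsin_pos.2 ht, arcsin_lt_pi_div_two.2 ht1⟩, ?_⟩
    simp only
    rw [sin_arcsin (by linarith) ht1.le]
    field_simp

section

variable {g G : ℝ → ℝ} {r : ℝ}

theorem injOn_mul_sin (hr : 0 < r) : InjOn (fun φ => r * sin φ) (Ioo 0 (π / 2)) := by
  intro x hx y hy h
  refine injOn_sin ⟨?_, hx.2.le⟩ ⟨?_, hy.2.le⟩ (mul_left_cancel₀ hr.ne' h)
  · linarith [hx.1, pi_pos]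
  · linarith [hy.1, pi_pos]

/-- The Jacobian `r cos φ` cancels the singular denominator. Here and below `G` stands for data
known only at positive times, and `g` for a function on the whole line agreeing with it there. -/
theorem abs_deriv_smul_sine_substitution (hr : 0 < r) (hG : ∀ t, 0 < t → G t = g t) {φ : ℝ}
    (hφ : φ ∈ Ioo 0 (π / 2)) :
    |r * cos φ| • (G (r * sin φ) / √(r ^ 2 - (r * sin φ) ^ 2)) = g (r * sin φ) := by
  have hs : 0 < sin φ := sin_pos_of_pos_of_lt_pi hφ.1 (by linarith [pi_pos, hφ.2])
  have hc : 0 < cos φ := cos_pos_of_mem_Ioo ⟨by linarith [hφ.1, pi_pos], hφ.2⟩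
  have h : r ^ 2 - (r * sin φ) ^ 2 = (r * cos φ) ^ 2 := by
    rw [mul_pow, mul_pow, cos_sq']
    ring
  rw [h, sqrt_sq (by positivity), abs_of_pos (by positivity), smul_eq_mul, hG _ (by positivity)]
  field_simp

theorem intervalIntegrable_div_sqrt (hg : Continuous g) (hr : 0 < r)
    (hG : ∀ t, 0 < t → G t = g t) :
    IntervalIntegrable (fun t => G t / √(r ^ 2 - t ^ 2)) volume 0 r := by
  rw [intervalIntegrable_iff_integrableOn_Ioo_of_le hr.le, ← image_sin_Ioo hr,
    integrableOn_image_iff_integrableOn_abs_deriv_smul measurableSet_Ioo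
      (fun x _ => ((hasDerivAt_sin x).const_mul r).hasDerivWithinAt) (injOn_mul_sin hr)]
  refine IntegrableOn.congr_fun ?_ (fun φ hφ =>
    (abs_deriv_smul_sine_substitution hr hG hφ).symm) measurableSet_Ioo
  have : Continuous fun φ => g (r * sin φ) := by fun_prop
  exact (this.integrableOn_Icc (a := 0) (b := π / 2)).mono_set Ioo_subset_Icc_self

theorem integral_div_sqrt (hr : 0 < r) (hG : ∀ t, 0 < t → G t = g t) :
    ∫ t in (0 : ℝ)..r, G t / √(r ^ 2 - t ^ 2) = sineIntegral g r := by
  rw [intervalIntegral.integral_of_le hr.le, integral_Ioc_eq_integral_Ioo, ← image_sin_Ioo hr,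
    integral_image_eq_integral_abs_deriv_smul measurableSet_Ioo
      (fun x _ => ((hasDerivAt_sin x).const_mul r).hasDerivWithinAt) (injOn_mul_sin hr),
    setIntegral_congr_fun measurableSet_Ioo
      fun φ hφ => abs_deriv_smul_sine_substitution hr hG hφ, sineIntegral,
    intervalIntegral.integral_of_le (by positivity), integral_Ioc_eq_integral_Ioo]

/-- With `u = tan θ / r` one has `√(u² + 1 / r²) = 1 / (r cos θ)`, so the time becomes `r cos θ` and
the powers of `cos θ` cancel. -/
theorem abs_deriv_smul_tan_substitution (hr : 0 < r) (hG : ∀ t, 0 < t → G t = g t) {θ : ℝ}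
    (hθ : θ ∈ Ioo (-(π / 2)) (π / 2)) :
    |r⁻¹ * (1 / cos θ ^ 2)| • (G (1 / √((r⁻¹ * tan θ) ^ 2 + (1 / r) ^ 2)) /
      √((r⁻¹ * tan θ) ^ 2 + (1 / r) ^ 2) ^ 2) = r * g (r * cos θ) := by
  have hc : 0 < cos θ := cos_pos_of_mem_Ioo hθ
  have h : (r⁻¹ * tan θ) ^ 2 + (1 / r) ^ 2 = (1 / (r * cos θ)) ^ 2 := by
    rw [tan_eq_sin_div_cos]
    field_simp
    linarith [sin_sq_add_cos_sq θ]
  rw [h, sqrt_sq (by positivity), one_div_one_div, hG _ (by positivity),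
    abs_of_pos (by positivity), smul_eq_mul]
  field_simp

theorem image_tan_Ioo_const_mul (hr : 0 < r) :
    (fun θ => r⁻¹ * tan θ) '' Ioo (-(π / 2)) (π / 2) = univ := by
  refine eq_univ_of_forall fun u => ?_
  obtain ⟨θ, hθ, h⟩ : r * u ∈ tan '' Ioo (-(π / 2)) (π / 2) := by
    rw [image_tan_Ioo]
    trivial
  refine ⟨θ, hθ, ?_⟩
  simp only [h]
  field_simp

theorem injOn_mul_tan (hr : 0 < r) :
    InjOn (fun θ => r⁻¹ * tan θ) (Ioo (-(π / 2)) (π / 2)) := fun _ hx _ hy h =>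
  injOn_tan hx hy (mul_left_cancel₀ (inv_ne_zero hr.ne') h)

theorem hasDerivWithinAt_mul_tan {θ : ℝ} (hθ : θ ∈ Ioo (-(π / 2)) (π / 2)) :
    HasDerivWithinAt (fun θ => r⁻¹ * tan θ) (r⁻¹ * (1 / cos θ ^ 2)) (Ioo (-(π / 2)) (π / 2)) θ :=
  ((hasDerivAt_tan (cos_pos_of_mem_Ioo hθ).ne').const_mul _).hasDerivWithinAt

theorem integrable_abelIntegrand (hg : Continuous g) (hr : 0 < r) (hG : ∀ t, 0 < t → G t = g t) :
    Integrable fun u : ℝ => G (1 / √(u ^ 2 + (1 / r) ^ 2)) / √(u ^ 2 + (1 / r) ^ 2) ^ 2 := by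
  rw [← integrableOn_univ, ← image_tan_Ioo_const_mul hr,
    integrableOn_image_iff_integrableOn_abs_deriv_smul measurableSet_Ioo
      (fun x hx => hasDerivWithinAt_mul_tan hx) (injOn_mul_tan hr)]
  refine IntegrableOn.congr_fun ?_ (fun φ hφ =>
    (abs_deriv_smul_tan_substitution hr hG hφ).symm) measurableSet_Ioo
  have : Continuous fun θ => r * g (r * cos θ) := by fun_prop
  exact (this.integrableOn_Icc (a := -(π / 2)) (b := π / 2)).mono_set Ioo_subset_Icc_self

theorem integral_sin_zero_pi (hg : Continuous g) :
    ∫ φ in (0 : ℝ)..π, g (r * sin φ) = 2 * sineIntegral g r := by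
  have hc : Continuous fun φ => g (r * sin φ) := by fun_prop
  rw [← intervalIntegral.integral_add_adjacent_intervals (hc.intervalIntegrable 0 (π / 2))
    (hc.intervalIntegrable (π / 2) π)]
  have h := intervalIntegral.integral_comp_sub_left (fun φ => g (r * sin φ)) (a := 0) (b := π / 2) π
  simp only [sin_pi_sub, sub_zero, show π - π / 2 = π / 2 by ring] at h
  rw [← h, sineIntegral]
  ring

theorem integral_sin_zero_two_pi (hg : Continuous g) (heven : ∀ s, g (-s) = g s) :
    ∫ φ in (0 : ℝ)..(2 * π), g (r * sin φ) = 4 * sineIntegral g r := by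
  have hc : Continuous fun φ => g (r * sin φ) := by fun_prop
  rw [← intervalIntegral.integral_add_adjacent_intervals (hc.intervalIntegrable 0 π)
    (hc.intervalIntegrable π (2 * π))]
  have h := intervalIntegral.integral_comp_add_right (fun φ => g (r * sin φ)) (a := 0) (b := π) π
  simp only [sin_add_pi, mul_neg, heven, zero_add, ← two_mul] at h
  rw [← h, integral_sin_zero_pi hg]
  ring

theorem abelTransform_eq (hg : Continuous g) (hr : 0 < r) (hG : ∀ t, 0 < t → G t = g t) :
    abelTransform (fun s => G (1 / s) / s ^ 2) (1 / r) = r * (2 * sineIntegral g r) := by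
  rw [abelTransform, ← setIntegral_univ, ← image_tan_Ioo_const_mul hr,
    integral_image_eq_integral_abs_deriv_smul measurableSet_Ioo
      (fun x hx => hasDerivWithinAt_mul_tan hx) (injOn_mul_tan hr),
    setIntegral_congr_fun measurableSet_Ioo
      fun φ hφ => abs_deriv_smul_tan_substitution hr hG hφ,
    ← integral_Ioc_eq_integral_Ioo, ← intervalIntegral.integral_of_le (by linarith [pi_pos]),
    intervalIntegral.integral_const_mul, ← integral_sin_zero_pi hg]
  have h := intervalIntegral.integral_comp_add_right (fun φ => g (r * sin φ))
    (a := -(π / 2)) (b := π / 2) (π / 2)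
  simp only [sin_add_pi_div_two, neg_add_cancel, add_halves] at h
  rw [h]

end

/-! ### Archimedes' hat-box theorem and Abel inversion -/

section HatBox

theorem sineIntegral_pow (n : ℕ) (τ : ℝ) :
    sineIntegral (fun s => s ^ n) τ = τ ^ n * ∫ φ in (0 : ℝ)..(π / 2), sin φ ^ n := by
  simp only [sineIntegral, mul_pow, intervalIntegral.integral_const_mul]

/-- Wallis: by the reduction formula, passing from `n` to `n + 1` multiplies the product by `(n + 1)
/ (n + 2)`. -/
theorem integral_sin_pow_mul_integral_sin_pow_succ (n : ℕ) :
    (∫ φ in (0 : ℝ)..(π / 2), sin φ ^ n) * (∫ φ in (0 : ℝ)..(π / 2), sin φ ^ (n + 1)) =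
      π / 2 / (n + 1) := by
  induction n with
  | zero => simp
  | succ n ih =>
    rw [integral_sin_pow n]
    simp only [sin_zero, cos_pi_div_two, mul_zero, ne_eq, Nat.add_eq_zero_iff, one_ne_zero,
      and_false, not_false_eq_true, zero_pow, zero_mul, sub_zero, zero_div, zero_add]
    rw [mul_left_comm, mul_comm (∫ φ in (0 : ℝ)..(π / 2), sin φ ^ (n + 1)), ih]
    push_cast
    field_simp
    ring

/-- The difference of the two sides of Archimedes' hat-box theorem for the zonal function `g`. -/
def hatBoxDefect (g : ℝ → ℝ) : ℝ :=
  (∫ θ in (0 : ℝ)..(π / 2), sin θ * sineIntegral g (sin θ)) - π / 2 * ∫ s in (0 : ℝ)..1, g s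

theorem hatBoxDefect_add {g h : ℝ → ℝ} (hg : Continuous g) (hh : Continuous h) :
    hatBoxDefect (fun s => g s + h s) = hatBoxDefect g + hatBoxDefect h := by
  have h1 : ∀ τ, sineIntegral (fun s => g s + h s) τ = sineIntegral g τ + sineIntegral h τ :=
    fun τ => intervalIntegral.integral_add (Continuous.intervalIntegrable (by fun_prop) _ _)
      (Continuous.intervalIntegrable (by fun_prop) _ _)
  have hg' := continuous_sineIntegral hg
  have hh' := continuous_sineIntegral hh
  simp only [hatBoxDefect, h1, mul_add]
  rw [intervalIntegral.integral_add (Continuous.intervalIntegrable (by fun_prop) _ _)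
      (Continuous.intervalIntegrable (by fun_prop) _ _),
    intervalIntegral.integral_add (hg.intervalIntegrable _ _) (hh.intervalIntegrable _ _)]
  ring

theorem hatBoxDefect_const_mul (c : ℝ) (g : ℝ → ℝ) :
    hatBoxDefect (fun s => c * g s) = c * hatBoxDefect g := by
  simp only [hatBoxDefect, sineIntegral, intervalIntegral.integral_const_mul, mul_left_comm _ c]
  ring

theorem hatBoxDefect_pow (n : ℕ) : hatBoxDefect (fun s => s ^ n) = 0 := by
  simp only [hatBoxDefect, sineIntegral_pow, ← mul_assoc, ← pow_succ',
    intervalIntegral.integral_mul_const, integral_pow]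
  rw [mul_comm, integral_sin_pow_mul_integral_sin_pow_succ]
  simp [div_eq_mul_inv]

theorem hatBoxDefect_polynomial (p : Polynomial ℝ) : hatBoxDefect (fun s => p.eval s) = 0 := by
  induction p using Polynomial.induction_on' with
  | add p q hp hq =>
    simp only [Polynomial.eval_add]
    rw [hatBoxDefect_add p.continuous q.continuous, hp, hq, add_zero]
  | monomial n a =>
    simp only [Polynomial.eval_monomial]
    rw [hatBoxDefect_const_mul, hatBoxDefect_pow, mul_zero]

/-- The defect is bounded by a multiple of the sup norm on `[0, 1]`, so its vanishing on polynomials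
extends to continuous functions by Weierstrass approximation. -/
theorem abs_hatBoxDefect_le {g : ℝ → ℝ} {ε : ℝ} (hg : ∀ s ∈ Icc (0 : ℝ) 1, |g s| ≤ ε) :
    |hatBoxDefect g| ≤ ((π / 2) ^ 2 + π / 2) * ε := by
  have hsin : ∀ φ ∈ uIoc (0 : ℝ) (π / 2), sin φ ∈ Icc (0 : ℝ) 1 := fun φ hφ => by
    rw [uIoc_of_le (by positivity)] at hφ
    exact ⟨sin_nonneg_of_nonneg_of_le_pi hφ.1.le (by linarith [hφ.2, pi_pos]), sin_le_one φ⟩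
  have h1 : ∀ τ ∈ Icc (0 : ℝ) 1, |sineIntegral g τ| ≤ ε * (π / 2) := fun τ hτ => by
    have := intervalIntegral.norm_integral_le_of_norm_le_const (a := 0) (b := π / 2)
      (f := fun φ => g (τ * sin φ)) (C := ε) fun φ hφ => hg _
        ⟨mul_nonneg hτ.1 (hsin φ hφ).1, mul_le_one₀ hτ.2 (hsin φ hφ).1 (hsin φ hφ).2⟩
    rwa [sub_zero, abs_of_nonneg (by positivity : (0 : ℝ) ≤ π / 2)] at this
  have h2 := intervalIntegral.norm_integral_le_of_norm_le_const (a := 0) (b := π / 2)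
    (f := fun θ => sin θ * sineIntegral g (sin θ)) (C := ε * (π / 2)) fun θ hθ => by
      rw [norm_mul, norm_eq_abs, norm_eq_abs, abs_of_nonneg (hsin θ hθ).1]
      exact (mul_le_of_le_one_left (abs_nonneg _) (hsin θ hθ).2).trans (h1 _ (hsin θ hθ))
  have h3 := intervalIntegral.norm_integral_le_of_norm_le_const (a := (0 : ℝ)) (b := 1)
    (f := g) (C := ε) fun s hs => hg s (by
      rw [uIoc_of_le zero_le_one] at hs
      exact ⟨hs.1.le, hs.2⟩)
  rw [sub_zero, abs_of_nonneg (by positivity : (0 : ℝ) ≤ π / 2)] at h2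
  rw [sub_zero, abs_one, mul_one] at h3
  calc |hatBoxDefect g| ≤ ε * (π / 2) * (π / 2) + π / 2 * ε := by
        refine (abs_sub _ _).trans (add_le_add h2 ?_)
        rw [abs_mul, abs_of_nonneg (by positivity : (0 : ℝ) ≤ π / 2)]
        gcongr
        exact h3
    _ = _ := by ring

/-- Averages of zonal functions over the sphere (Archimedes' hat-box theorem). -/
theorem integral_sin_mul_sineIntegral {g : ℝ → ℝ} (hg : Continuous g) :
    ∫ θ in (0 : ℝ)..(π / 2), sin θ * sineIntegral g (sin θ) = π / 2 * ∫ s in (0 : ℝ)..1, g s := by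
  suffices h : hatBoxDefect g = 0 from sub_eq_zero.1 h
  have key : ∀ ε > 0, |hatBoxDefect g| ≤ ((π / 2) ^ 2 + π / 2) * ε := fun ε hε => by
    obtain ⟨p, hp⟩ := exists_polynomial_near_of_continuousOn 0 1 g hg.continuousOn ε hε
    have h1 := hatBoxDefect_add (p.continuous) (hg.sub p.continuous)
    simp only [Pi.sub_apply, add_sub_cancel, hatBoxDefect_polynomial, zero_add] at h1
    rw [h1]
    refine abs_hatBoxDefect_le fun s hs => ?_
    rw [Pi.sub_apply, abs_sub_comm]
    exact (hp s hs).le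
  refine abs_nonpos_iff.1 (le_of_forall_pos_le_add fun δ hδ => ?_)
  have hK : 0 < (π / 2) ^ 2 + π / 2 := by positivity
  refine (key (δ / ((π / 2) ^ 2 + π / 2)) (by positivity)).trans (le_of_eq ?_)
  field_simp
  ring

/-- Abel inversion before differentiating: `r = τ sin θ` reduces it to the hat-box identity for `s ↦
g (τ s)`, and `2 / π` cancels its constant. -/
theorem integral_mul_sineIntegral_div_sqrt {g : ℝ → ℝ} (hg : Continuous g) {τ : ℝ} (hτ : 0 < τ) :
    ∫ r in (0 : ℝ)..τ, r * (2 / π * sineIntegral g r) / √(τ ^ 2 - r ^ 2) =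
      ∫ s in (0 : ℝ)..τ, g s := by
  have h1 := integral_sin_mul_sineIntegral (g := fun s => g (τ * s)) (by fun_prop)
  have h2 : ∀ θ, sineIntegral (fun s => g (τ * s)) (sin θ) = sineIntegral g (τ * sin θ) :=
    fun θ => by simp only [sineIntegral, mul_assoc]
  simp only [h2] at h1
  rw [integral_div_sqrt (g := fun r => r * (2 / π * sineIntegral g r)) hτ fun _ _ => rfl]
  simp only [sineIntegral] at h1 ⊢
  calc _ = ∫ θ in (0 : ℝ)..(π / 2), (τ * (2 / π)) *
        (sin θ * ∫ φ in (0 : ℝ)..(π / 2), g (τ * sin θ * sin φ)) := by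
        congr 1 with θ
        ring
    _ = τ * ∫ s in (0 : ℝ)..1, g (τ * s) := by
        rw [intervalIntegral.integral_const_mul, h1]
        field_simp
    _ = _ := by
        rw [← smul_eq_mul, intervalIntegral.smul_integral_comp_mul_left]
        simp

end HatBox

end Photoacoustic
end

noncomputable section

namespace Photoacoustic

open Filter MeasureTheory Set

/-! ### Circular means of the initial data -/

theorem continuous_circle : Continuous fun α : ℝ => !₂[Real.cos α, Real.sin α] := by
  refine (PiLp.continuous_toLp 2 _).comp (continuous_pi fun i => ?_)
  fin_cases i
  · exact Real.continuous_cos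
  · exact Real.continuous_sin

theorem exists_inner_circle_eq (k : Plane) :
    ∃ γ : ℝ, ∀ α : ℝ, (inner ℝ k !₂[Real.cos α, Real.sin α] : ℝ) = ‖k‖ * Real.sin (α + γ) := by
  -- The coordinates are swapped because the target is a sine: `γ` must satisfy `‖k‖ cos γ = k 1`
  -- and `‖k‖ sin γ = k 0`.
  have h1 := Complex.norm_mul_cos_arg ⟨k 1, k 0⟩
  have h2 := Complex.norm_mul_sin_arg ⟨k 1, k 0⟩
  have h3 : ‖(⟨k 1, k 0⟩ : ℂ)‖ = ‖k‖ := by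
    rw [EuclideanSpace.norm_eq, Complex.norm_eq_sqrt_sq_add_sq]
    simp [Fin.sum_univ_two, add_comm]
  rw [h3] at h1 h2
  refine ⟨Complex.arg ⟨k 1, k 0⟩, fun α => ?_⟩
  rw [Real.sin_add]
  simp only [PiLp.inner_apply, Fin.sum_univ_two]
  simp at h1 h2 ⊢
  linear_combination -Real.cos α * h2 - Real.sin α * h1

/-- A plane wave on a circle at time `0` takes the values it has at the centre at times `r sin(α +
γ)`; reversing the direction of travel shifts `γ` by `π`. The shift depends on `k`, but it
disappears after integration over a period. -/
theorem exists_wavePhase_circle_eq {σ : ℝ} (hσ : σ = 1 ∨ σ = -1) (ξ k : Plane) (r : ℝ) :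
    ∃ γ : ℝ, ∀ α : ℝ, wavePhase (ContinuousLinearMap.id ℝ Plane) σ k
      (ξ + r • !₂[Real.cos α, Real.sin α], 0) =
        wavePhase (ContinuousLinearMap.id ℝ Plane) σ k (ξ, r * Real.sin (α + γ)) := by
  obtain ⟨γ, hγ⟩ := exists_inner_circle_eq k
  rcases hσ with rfl | rfl
  · refine ⟨γ, fun α => ?_⟩
    simp only [wavePhase_apply, ContinuousLinearMap.id_apply, inner_add_right, inner_smul_right, hγ]
    ring
  · refine ⟨γ + Real.pi, fun α => ?_⟩
    simp only [wavePhase_apply, ContinuousLinearMap.id_apply, inner_add_right, inner_smul_right, hγ,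
      ← add_assoc, Real.sin_add_pi]
    ring

theorem integral_comp_add_of_periodic {F : Type*} [NormedAddCommGroup F] [NormedSpace ℝ F]
    {g : ℝ → F} {T : ℝ} (hg : Function.Periodic g T) (γ : ℝ) :
    ∫ α in (0 : ℝ)..T, g (α + γ) = ∫ α in (0 : ℝ)..T, g α := by
  rw [intervalIntegral.integral_comp_add_right, zero_add, add_comm T,
    hg.intervalIntegral_add_eq γ 0, zero_add]

theorem integral_superposition_circle {σ : ℝ} (hσ : σ = 1 ∨ σ = -1) (h : 𝓢(Plane, ℂ)) (ξ : Plane)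
    (r : ℝ) :
    ∫ α in (0 : ℝ)..(2 * Real.pi), superposition (wavePhase (ContinuousLinearMap.id ℝ Plane) σ) h
      (ξ + r • !₂[Real.cos α, Real.sin α], 0) =
    ∫ α in (0 : ℝ)..(2 * Real.pi), superposition (wavePhase (ContinuousLinearMap.id ℝ Plane) σ) h
      (ξ, r * Real.sin α) := by
  have hint : ∀ x : ℝ → Plane × ℝ, Continuous x → Integrable (Function.uncurry fun α k =>
      Complex.exp ((2 * Real.pi * wavePhase (ContinuousLinearMap.id ℝ Plane) σ k (x α) : ℝ) *
        Complex.I) * h k) ((volume.restrict (uIoc 0 (2 * Real.pi))).prod volume) := by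
    intro x hx
    have h0 : Integrable (fun q : ℝ × Plane => (1 : ℂ) * h q.2)
        ((volume.restrict (uIoc 0 (2 * Real.pi))).prod volume) :=
      (intervalIntegrable_iff.1 (intervalIntegrable_const (c := (1 : ℂ)))).mul_prod h.integrable
    refine h0.mono ?_ (Eventually.of_forall fun q => ?_)
    · have h2 := h.continuous
      refine Continuous.aestronglyMeasurable ?_
      simp only [Function.uncurry_def, wavePhase_apply]
      fun_prop
    · simp only [Function.uncurry_def]
      rw [norm_planeWave, one_mul]
  have hcirc := continuous_circle
  simp only [superposition]
  rw [intervalIntegral_integral_swap (hint _ (by fun_prop)),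
    intervalIntegral_integral_swap (hint _ (by fun_prop))]
  congr 1 with k
  obtain ⟨γ, hγ⟩ := exists_wavePhase_circle_eq hσ ξ k r
  simp only [hγ]
  refine integral_comp_add_of_periodic (g := fun α => Complex.exp ((2 * Real.pi *
    wavePhase (ContinuousLinearMap.id ℝ Plane) σ k (ξ, r * Real.sin α) : ℝ) * Complex.I) * h k)
    (fun α => ?_) γ
  simp only [Real.sin_periodic α]

variable (f : Plane → ℝ) (hf : ContDiff ℝ ∞ f) (hc : HasCompactSupport f)

theorem integral_planarPressure_circle (ξ : Plane) (r : ℝ) :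
    ∫ α in (0 : ℝ)..(2 * Real.pi), planarPressure f hf hc
      (ξ + r • !₂[Real.cos α, Real.sin α], 0) =
    ∫ α in (0 : ℝ)..(2 * Real.pi), planarPressure f hf hc (ξ, r * Real.sin α) := by
  have hcirc := continuous_circle
  have hcont : ∀ σ : ℝ, σ ^ 2 = 1 → ∀ x : ℝ → Plane × ℝ, Continuous x → IntervalIntegrable
      (fun α => superposition (wavePhase (ContinuousLinearMap.id ℝ Plane) σ)
        (FourierTransform.fourier (complexTest f hf hc) : 𝓢(Plane, ℂ)) (x α))
      volume 0 (2 * Real.pi) := fun σ hσ x hx =>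
    ((isWaveFunction_superposition (fun _ => rfl) hσ
      (HasMoments.of_schwartz _)).contDiff.continuous.comp hx).intervalIntegrable _ _
  simp only [planarPressure, standingWave, intervalIntegral.integral_const_mul]
  rw [intervalIntegral.integral_add (hcont 1 (by norm_num) _ (by fun_prop))
      (hcont (-1) (by norm_num) _ (by fun_prop)),
    intervalIntegral.integral_add (hcont 1 (by norm_num) _ (by fun_prop))
      (hcont (-1) (by norm_num) _ (by fun_prop)),
    integral_superposition_circle (Or.inl rfl), integral_superposition_circle (Or.inr rfl)]

/-- The pressure is even in time, so the full period is four quarter periods, and `4 / (2π) = 2 /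
π`. -/
theorem circularMean_eq_sineIntegral (ξ : Plane) (r : ℝ) :
    circularMean f ξ r = 2 / Real.pi * sineIntegral (fun t => pressure f hf hc (ξ, t)) r := by
  have h := integral_planarPressure_circle f hf hc ξ r
  simp only [← ofReal_pressure, pressure_zero, intervalIntegral.integral_ofReal] at h
  have hg : Continuous fun t => pressure f hf hc (ξ, t) :=
    (continuous_pressure f hf hc).comp (by fun_prop)
  rw [circularMean, Complex.ofReal_injective h,
    integral_sin_zero_two_pi hg (pressure_neg f hf hc ξ)]
  field_simp
  ring

end Photoacoustic
end

/-! ### The main theorem -/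

theorem mainTheorem4 (Ω : Set Photoacoustic.Plane) (hΩ_open : IsOpen Ω) (hΩ_convex : Convex ℝ Ω)
    (f : Photoacoustic.Plane → ℝ) (hf : ContDiff ℝ ∞ f) (hf_compact : HasCompactSupport f)
    (hf_supp : tsupport f ⊆ Ω)
    (p : ℝ → 𝓢'(Photoacoustic.Space3, ℂ))
    (hp : Photoacoustic.IsDistributionalWaveSolution p
      (Photoacoustic.planarSource f hf hf_compact)) :
    -- the vertically integrated pressure exists
    (∃ P : Photoacoustic.Plane → ℝ → ℝ, Photoacoustic.IsVerticallyIntegrated p P) ∧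
    ∀ P : Photoacoustic.Plane → ℝ → ℝ, Photoacoustic.IsVerticallyIntegrated p P →
      -- it solves the two-dimensional wave equation
      Photoacoustic.IsClassicalWaveSolution P f ∧
      -- the circular means of the initial data, at all points of the plane
      (∀ ξ : Photoacoustic.Plane, ∀ r : ℝ, 0 < r →
        MeasureTheory.Integrable
          (fun u : ℝ => P ξ (1 / Real.sqrt (u ^ 2 + (1 / r) ^ 2)) /
            Real.sqrt (u ^ 2 + (1 / r) ^ 2) ^ 2) ∧
        Photoacoustic.circularMean f ξ r =
          1 / (Real.pi * r) *
            Photoacoustic.abelTransform (fun s => P ξ (1 / s) / s ^ 2) (1 / r) ∧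
        IntervalIntegrable (fun t => P ξ t / Real.sqrt (r ^ 2 - t ^ 2))
          MeasureTheory.volume 0 r ∧
        Photoacoustic.circularMean f ξ r =
          2 / Real.pi * ∫ t in (0 : ℝ)..r, P ξ t / Real.sqrt (r ^ 2 - t ^ 2)) ∧
      -- the line detector data determine the circular means centred on the boundary, and conversely
      ∀ m₁ : frontier Ω → ℝ → ℝ, (∀ ξ : frontier Ω, ∀ t : ℝ, 0 < t → m₁ ξ t = P ξ t) →
        (∀ ξ : frontier Ω, ∀ r : ℝ, 0 < r →
          IntervalIntegrable (fun t => m₁ ξ t / Real.sqrt (r ^ 2 - t ^ 2))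
            MeasureTheory.volume 0 r ∧
          Photoacoustic.circularMean f ξ r =
            2 / Real.pi * ∫ t in (0 : ℝ)..r, m₁ ξ t / Real.sqrt (r ^ 2 - t ^ 2)) ∧
        (∀ ξ : frontier Ω, ∀ t : ℝ, 0 < t →
          HasDerivAt
            (fun τ : ℝ => ∫ r in (0 : ℝ)..τ,
              r * Photoacoustic.circularMean f ξ r / Real.sqrt (τ ^ 2 - r ^ 2))
            (m₁ ξ t) t) := by
  have hvi := Photoacoustic.isVerticallyIntegrated_pressure f hf hf_compact hp
  refine ⟨⟨_, hvi⟩, fun P hPvi => ?_⟩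
  -- Uniqueness of vertical integrals identifies an arbitrary `P` with the Fourier solution, at
  -- nonnegative times only.
  have hP : ∀ ξ t, 0 ≤ t → P ξ t = Photoacoustic.pressure f hf hf_compact (ξ, t) := fun ξ t ht =>
    congrFun ((hPvi t ht).unique (hvi t ht)) ξ
  have hcont : ∀ ξ, Continuous fun t => Photoacoustic.pressure f hf hf_compact (ξ, t) := fun ξ =>
    (Photoacoustic.continuous_pressure f hf hf_compact).comp (by fun_prop)
  have hmean := Photoacoustic.circularMean_eq_sineIntegral f hf hf_compact
  refine ⟨Photoacoustic.isClassicalWaveSolution_of_eq_pressure f hf hf_compact hP,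
    fun ξ r hr => ?_, fun m₁ hm => ?_⟩
  · have hG : ∀ t, 0 < t → P ξ t = Photoacoustic.pressure f hf hf_compact (ξ, t) := fun t ht =>
      hP ξ t ht.le
    refine ⟨Photoacoustic.integrable_abelIntegrand (hcont ξ) hr hG, ?_,
      Photoacoustic.intervalIntegrable_div_sqrt (hcont ξ) hr hG, ?_⟩
    · rw [hmean, Photoacoustic.abelTransform_eq (hcont ξ) hr hG]
      field_simp
    · rw [hmean, Photoacoustic.integral_div_sqrt hr hG]
  · have hG : ∀ (ξ : frontier Ω) t, 0 < t →
        m₁ ξ t = Photoacoustic.pressure f hf hf_compact (ξ, t) := fun ξ t ht =>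
      (hm ξ t ht).trans (hP ξ t ht.le)
    refine ⟨fun ξ r hr => ⟨Photoacoustic.intervalIntegrable_div_sqrt (hcont ξ) hr (hG ξ), ?_⟩,
      fun ξ t ht => ?_⟩
    · rw [hmean, Photoacoustic.integral_div_sqrt hr (hG ξ)]
    -- The Abel-type integral equals `∫₀^τ` of the continuous pressure for all `τ > 0`, hence near
    -- `t`, so the fundamental theorem of calculus gives its derivative.
    · have h := intervalIntegral.integral_hasDerivAt_right ((hcont ξ).intervalIntegrable 0 t)
        ((hcont ξ).stronglyMeasurableAtFilter _ _) (hcont ξ).continuousAt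
      rw [hG ξ t ht]
      refine h.congr_of_eventuallyEq ?_
      filter_upwards [lt_mem_nhds ht] with τ hτ
      simp only [hmean]
      exact Photoacoustic.integral_mul_sineIntegral_div_sqrt (hcont ξ) hτ
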